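/- Let $d\ge 2$, let $\Omega^-\subset\mathbb{R}^d$ be a bounded open set whose boundary $\Gamma=\partial\Omega^-$ is a $C^\infty$ embedded hypersurface, let $L^2(\Gamma)$ be the space of complex-valued square-integrable functions with respect to surface measure, and let $\Delta_\Gamma$ be the Laplace–Beltrami operator of the metric induced on $\Gamma$ by $\mathbb{R}^d$. For $s\ge 0$ let $$\|w\|_{H^s(\Gamma)}^2=\sum_i\|(\chi_i w)\circ\kappa_i\|_{H^s(\mathbb{R}^{d-1})}^2,\qquad \|g\|_{H^s(\mathbb{R}^{d-1})}^2=\int_{\mathbb{R}^{d-1}}(1+|\xi|^2)^s|\widehat g(\xi)|^2\,d\xi,$$ where $(\kappa_i)$ is a finite family of smooth local parametrizations of $\Gamma$ by open subsets of $\mathbb{R}^{d-1}$, whose images cover $\Gamma$, $(\chi_i)$ is a smooth partition of unity on $\Gamma$ subordinate to their images, and $(\chi_i w)\circ\kappa_i$ is extended by zero. Given an orthonormal basis $(u_j)_{j\ge1}$ of $L^2(\Gamma)$ with $(-\Delta_\Gamma-\lambda_j)u_j=0$ in the sense of distributions, $\lambda_j\in\mathbb{R}$, and a bounded function $f:\mathbb{R}\to\mathbb{C}$,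 define $$f(-k^{-2}\Delta_\Gamma)v=\sum_{j=1}^\infty f(k^{-2}\lambda_j)\,(v,u_j)_{L^2(\Gamma)}\,u_j,\qquad v\in L^2(\Gamma),\ k>0.$$ Suppose that $f$ is bounded with compact support. Then for all $s\ge 0$ and all $k_0>0$ there exists $C>0$, depending only on $s$, $f$, $k_0$ and $\Gamma$ with the chosen parametrizations and partition of unity (and not on $k$ or on the basis), such that $f(-k^{-2}\Delta_\Gamma)$ maps $L^2(\Gamma)$ into $H^s(\Gamma)$ and $$\|f(-k^{-2}\Delta_\Gamma)\|_{L^2(\Gamma)\to H^s(\Gamma)}\le C\,k^s\qquad\text{for all } k\ge k_0.$$ -/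

import Mathlib

open MeasureTheory FourierTransform
open scoped ENNReal ContDiff

noncomputable section

/-- A smooth local parametrization of `Γ ⊆ ℝⁿ⁺¹` by an open set of `ℝⁿ`: an injective smooth
immersion which is a homeomorphism onto a relatively open subset of `Γ`. -/
structure SurfaceChart {n : ℕ} (Γ : Set (EuclideanSpace ℝ (Fin (n + 1)))) where
  source : Set (EuclideanSpace ℝ (Fin n))
  isOpen_source : IsOpen source
  param : EuclideanSpace ℝ (Fin n) → EuclideanSpace ℝ (Fin (n + 1))
  contDiffOn_param : ContDiffOn ℝ ∞ param source
  injOn_param : Set.InjOn param source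
  injective_fderiv : ∀ x ∈ source, Function.Injective (fderiv ℝ param x)
  /-- `param` is an open map from `source` to `Γ` with its relative topology. -/
  isOpen_image : ∀ W ⊆ source, IsOpen W →
    ∃ U : Set (EuclideanSpace ℝ (Fin (n + 1))), IsOpen U ∧ param '' W = Γ ∩ U

/-- `Γ` is a `C^∞` embedded hypersurface of `ℝⁿ⁺¹`. -/
def IsSmoothHypersurface {n : ℕ} (Γ : Set (EuclideanSpace ℝ (Fin (n + 1)))) : Prop :=
  ∀ p ∈ Γ, ∃ κ : SurfaceChart Γ, p ∈ κ.param '' κ.source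

/-- The surface measure of `Γ`: the `n`-dimensional Hausdorff measure (normalized so that it is
Lebesgue measure on `ℝⁿ`), restricted to `Γ`. -/
def surfaceMeasure {n : ℕ} (Γ : Set (EuclideanSpace ℝ (Fin (n + 1)))) :
    Measure (EuclideanSpace ℝ (Fin (n + 1))) :=
  (μHE[n] : Measure (EuclideanSpace ℝ (Fin (n + 1)))).restrict Γ

/-- The complex Hilbert space `L²(Γ)`. -/
abbrev SurfaceL2 {n : ℕ} (Γ : Set (EuclideanSpace ℝ (Fin (n + 1)))) : Type :=
  Lp ℂ 2 (surfaceMeasure Γ)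

/-- The partial derivative `∂ᵢ F (x)`. -/
def partialDeriv {n : ℕ} {F : Type*} [NormedAddCommGroup F] [NormedSpace ℝ F] (i : Fin n)
    (φ : EuclideanSpace ℝ (Fin n) → F) (x : EuclideanSpace ℝ (Fin n)) : F :=
  fderiv ℝ φ x (EuclideanSpace.single i 1)

namespace SurfaceChart

variable {n : ℕ} {Γ : Set (EuclideanSpace ℝ (Fin (n + 1)))}

/-- The induced Riemannian metric `g i j = ∂ᵢκ · ∂ⱼκ` in the chart `κ`. -/
def gram (κ : SurfaceChart Γ) (x : EuclideanSpace ℝ (Fin n)) : Matrix (Fin n) (Fin n) ℝ :=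
  Matrix.of fun i j => inner ℝ (partialDeriv i κ.param x) (partialDeriv j κ.param x)

/-- The surface element `√(det g)` in the chart `κ`. -/
def density (κ : SurfaceChart Γ) (x : EuclideanSpace ℝ (Fin n)) : ℝ :=
  Real.sqrt (κ.gram x).det

/-- The Laplace–Beltrami operator `Δ_Γ ψ = (det g)^{-1/2} ∑ᵢ ∂ᵢ ((det g)^{1/2} ∑ⱼ gⁱʲ ∂ⱼ ψ)` in the
chart `κ`, for a smooth function `ψ` of the local coordinates. -/
def laplaceBeltrami (κ : SurfaceChart Γ) (ψ : EuclideanSpace ℝ (Fin n) → ℝ)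
    (x : EuclideanSpace ℝ (Fin n)) : ℝ :=
  (κ.density x)⁻¹ * ∑ i, partialDeriv i
    (fun y => κ.density y * ∑ j, (κ.gram y)⁻¹ i j * partialDeriv j ψ y) x

end SurfaceChart

/-- `(-Δ_Γ - l) u = 0` for `u ∈ L²(Γ)`, in the sense of distributions: in every chart `κ`,
`∫ u (-Δ_Γ ψ) ds = l ∫ u ψ ds` for all test functions `ψ` supported in the chart, the surface
integrals being written in local coordinates, `ds = √(det g) dx`. -/
def IsLaplaceEigen {n : ℕ} (Γ : Set (EuclideanSpace ℝ (Fin (n + 1)))) (u : SurfaceL2 Γ)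
    (l : ℝ) : Prop :=
  ∀ (κ : SurfaceChart Γ) (ψ : EuclideanSpace ℝ (Fin n) → ℝ),
    ContDiff ℝ ∞ ψ → HasCompactSupport ψ → tsupport ψ ⊆ κ.source →
      ∫ x in κ.source, (-(κ.laplaceBeltrami ψ x) * κ.density x) • u (κ.param x) =
        (l : ℂ) * ∫ x in κ.source, (ψ x * κ.density x) • u (κ.param x)

/-- The function `f(-c Δ_Γ)` of the Laplace–Beltrami operator, applied to `v ∈ L²(Γ)`, through the
expansion in an orthonormal basis `u` of eigenfunctions with eigenvalues `lam`:
`f(-c Δ_Γ) v = ∑ⱼ f(c λⱼ) (v, uⱼ) uⱼ`. -/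
def funcLaplace {n : ℕ} {Γ : Set (EuclideanSpace ℝ (Fin (n + 1)))}
    (u : HilbertBasis ℕ ℂ (SurfaceL2 Γ)) (lam : ℕ → ℝ) (f : ℝ → ℂ) (c : ℝ)
    (v : SurfaceL2 Γ) : SurfaceL2 Γ :=
  ∑' j, (f (c * lam j) * inner ℂ (u j) v) • u j

/-- For bounded `f` the series defining `f(-c Δ_Γ) v` converges in `L²(Γ)`. -/
theorem hasSum_funcLaplace {n : ℕ} {Γ : Set (EuclideanSpace ℝ (Fin (n + 1)))}
    (u : HilbertBasis ℕ ℂ (SurfaceL2 Γ)) (lam : ℕ → ℝ) (f : ℝ → ℂ) (c : ℝ)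
    (v : SurfaceL2 Γ) {M : ℝ} (hM : ∀ t, ‖f t‖ ≤ M) :
    HasSum (fun j => (f (c * lam j) * inner ℂ (u j) v) • u j) (funcLaplace u lam f c v) := by
  have hmem : Memℓp (fun j => f (c * lam j) * inner ℂ (u j) v) 2 := by
    have h1 : Memℓp (fun j => (M : ℂ) * inner ℂ (u j) v) 2 := by
      have h2 := (lp.memℓp (u.repr v)).const_mul (M : ℂ)
      have e : (fun j => (M : ℂ) * (u.repr v : ℕ → ℂ) j) =
          (fun j => (M : ℂ) * inner ℂ (u j) v) := by
        funext j
        rw [u.repr_apply_apply]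
      rwa [← e]
    have hM0 : 0 ≤ M := (norm_nonneg _).trans (hM 0)
    rw [memℓp_gen_iff (by norm_num)] at h1 ⊢
    refine h1.of_nonneg_of_le (fun j => by positivity) fun j => ?_
    refine Real.rpow_le_rpow (norm_nonneg _) ?_ (by norm_num)
    rw [norm_mul, norm_mul]
    refine mul_le_mul_of_nonneg_right ((hM _).trans ?_) (norm_nonneg _)
    simp [abs_of_nonneg hM0]
  exact (u.hasSum_repr_symm ⟨_, hmem⟩).summable.hasSum

open scoped Classical in
/-- The norm `‖g‖_{Hˢ(ℝⁿ)} = (∫ (1 + |ξ|²)ˢ |ĝ(ξ)|² dξ)^{1/2}`, `s ≥ 0`, with the Fourier transform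
`ĝ` of `L²(ℝⁿ)`; it is `∞` unless `g ∈ Hˢ(ℝⁿ)`. -/
def sobolevENorm {n : ℕ} (s : ℝ) (g : EuclideanSpace ℝ (Fin n) → ℂ) : ℝ≥0∞ :=
  if h : MemLp g 2 volume then
    (∫⁻ ξ, ENNReal.ofReal ((1 + ‖ξ‖ ^ 2) ^ s) *
      ‖(𝓕 (h.toLp g) : Lp ℂ 2 (volume : Measure (EuclideanSpace ℝ (Fin n)))) ξ‖ₑ ^ 2) ^ (1 / 2 : ℝ)
  else ∞

/-- A finite atlas of `Γ` together with a smooth partition of unity subordinate to it. -/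
structure SobolevAtlas {n : ℕ} (Γ : Set (EuclideanSpace ℝ (Fin (n + 1)))) where
  size : ℕ
  chart : Fin size → SurfaceChart Γ
  cutoff : Fin size → EuclideanSpace ℝ (Fin (n + 1)) → ℝ
  contDiff_cutoff : ∀ i, ContDiff ℝ ∞ (cutoff i)
  cutoff_nonneg : ∀ i p, 0 ≤ cutoff i p
  support_cutoff : ∀ i, Γ ∩ tsupport (cutoff i) ⊆ (chart i).param '' (chart i).source
  sum_cutoff : ∀ p ∈ Γ, ∑ i, cutoff i p = 1

namespace SobolevAtlas

variable {n : ℕ} {Γ : Set (EuclideanSpace ℝ (Fin (n + 1)))}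

/-- The `i`-th localized piece `(χᵢ w) ∘ κᵢ` of `w`, extended by zero to `ℝⁿ`. -/
def localPiece (A : SobolevAtlas Γ) (i : Fin A.size) (w : EuclideanSpace ℝ (Fin (n + 1)) → ℂ) :
    EuclideanSpace ℝ (Fin n) → ℂ :=
  (A.chart i).source.indicator fun x =>
    A.cutoff i ((A.chart i).param x) • w ((A.chart i).param x)

/-- The norm `‖w‖_{Hˢ(Γ)} = (∑ᵢ ‖(χᵢ w) ∘ κᵢ‖²_{Hˢ(ℝⁿ)})^{1/2}`, `s ≥ 0`; it is `∞` unless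
`w ∈ Hˢ(Γ)`. Different atlases give equivalent norms. -/
def surfaceSobolevENorm (A : SobolevAtlas Γ) (s : ℝ) (w : SurfaceL2 Γ) : ℝ≥0∞ :=
  (∑ i, sobolevENorm s (A.localPiece i w) ^ 2) ^ (1 / 2 : ℝ)

end SobolevAtlas

end

/-! Put `w = f(-k⁻²Δ_Γ)v`. Since `f` vanishes outside some `[-R, R]`, only eigenvalues with `|λ| ≤ R
k²` contribute, so every iterate `W m = (-Δ_Γ)^m w` lies in `L²(Γ)` with `‖W m‖ ≤ (R k²)^m M ‖v‖`,
where `|f| ≤ M` (`isIteratedSol_funcLaplace`), and `-Δ_Γ (W m) = W (m + 1)` holds weakly in every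
chart. Elliptic regularity turns these bounds into Sobolev bounds; the point is to keep it uniform
in `k`, which is done by measuring frequencies with the weight `(1 + |ξ|/k)^r`.

One step of regularity (`exists_scaledSobolevSq_succ_le`) is a parametrix computation made by hand.
The weak equation is tested against `q(x, ν) e^{-2πi t x·ν}` with `q = χ / a(x, ν)`, `a` being the
principal symbol. The term of order `t²` returns `4π² t² 𝓕(χ w)(tν)`; the other terms are `O(t)` and
involve Fourier transforms of smooth cutoffs times `w` or `W 1`. For `t > k` division by `t²` gains
a factor `1 + t/k`, with `W 1` entering as `k⁻² W 1`; for `t ≤ k` that factor is at most 2 and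
nothing is needed. Multiplication by the smooth cutoffs preserves the weighted norms, uniformly in
`ν` on the sphere and in `k ≥ k₀` (`IsSymbol.exists_freqWeight_mul_fourier_le`).

Iterating over `r` with growing cutoffs (`exists_scaledSobolevSq_le`), each factor `k²` from passing
to the next iterate meets a factor `k⁻²`. Hence the weighted norm of order `r = ⌈s⌉` is `O(‖v‖)`,
and comparing the weight with `(1 + |ξ|²)^{s/2}` costs exactly `k^s`. -/

/-! ### Fourier integrals, Plancherel and products -/

section FourierAnalysis

variable {V : Type*} [NormedAddCommGroup V] [InnerProductSpace ℝ V] [FiniteDimensional ℝ V]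
  [MeasurableSpace V] [BorelSpace V]

/-- On `L¹ ∩ L²` the Fourier transform of `L²` is the Fourier integral. -/
theorem fourier_toLp_ae_eq {g : V → ℂ} (h2 : MemLp g 2 volume) (h1 : Integrable g volume) :
    ((𝓕 (h2.toLp g) : Lp ℂ 2 (volume : Measure V)) : V → ℂ) =ᵐ[volume] 𝓕 g := by
  have hcont : Continuous (𝓕 g) :=
    VectorFourier.fourierIntegral_continuous Real.continuous_fourierChar
      (by exact continuous_inner) h1
  -- Both sides are paired with test functions: for the `L²` transform the Fourier transform moves
  -- to `φ` through tempered distributions, for the integral through the multiplication formula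
  -- `e3`.
  refine ae_eq_of_integral_contDiff_smul_eq ((Lp.memLp _).locallyIntegrable (by norm_num))
    hcont.locallyIntegrable fun φ hφ hφc => ?_
  have hφC : ContDiff ℝ ∞ (fun x => (φ x : ℂ)) := Complex.ofRealCLM.contDiff.comp hφ
  have hφCc : HasCompactSupport (fun x => (φ x : ℂ)) :=
    hφc.comp_left (g := fun t : ℝ => (t : ℂ)) Complex.ofReal_zero
  let Φ := hφCc.toSchwartzMap hφC
  have hΦ : ∀ x, Φ x = (φ x : ℂ) := fun x => rfl
  have e1 : ∫ x, φ x • (𝓕 (h2.toLp g) : Lp ℂ 2 (volume : Measure V)) x =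
      Lp.toTemperedDistribution (𝓕 (h2.toLp g)) Φ := by
    rw [Lp.toTemperedDistribution_apply]
    simp [hΦ]
  rw [e1, ← Lp.fourier_toTemperedDistribution_eq, TemperedDistribution.fourier_apply,
    Lp.toTemperedDistribution_apply]
  have e2 : ∫ x, (𝓕 Φ) x • (h2.toLp g) x = ∫ x, 𝓕 (fun x => (φ x : ℂ)) x • g x := by
    refine integral_congr_ae ?_
    filter_upwards [h2.coeFn_toLp] with x hx
    rw [hx, SchwartzMap.fourier_coe]
    rfl
  rw [e2]
  have e3 := VectorFourier.integral_fourierIntegral_smul_eq_flip (L := innerₗ V)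
    Real.continuous_fourierChar continuous_inner (Φ.integrable (μ := volume)) h1
  rw [flip_innerₗ] at e3
  exact e3.trans (by simp [hΦ]; rfl)

/-- Plancherel for functions in `L¹ ∩ L²`. -/
theorem lintegral_enorm_fourier_sq {g : V → ℂ} (h2 : MemLp g 2 volume)
    (h1 : Integrable g volume) :
    ∫⁻ ξ, ‖𝓕 g ξ‖ₑ ^ 2 = ∫⁻ x, ‖g x‖ₑ ^ 2 := by
  have key : ∀ w : Lp ℂ 2 (volume : Measure V), ∫⁻ x, ‖w x‖ₑ ^ 2 = ‖w‖ₑ ^ 2 := by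
    intro w
    rw [Lp.enorm_def, eLpNorm_eq_lintegral_rpow_enorm_toReal (by norm_num) (by norm_num)]
    simp only [ENNReal.toReal_ofNat, ENNReal.rpow_ofNat]
    rw [← ENNReal.rpow_natCast, ← ENNReal.rpow_mul]
    norm_num
  have e1 : ∫⁻ ξ, ‖𝓕 g ξ‖ₑ ^ 2 = ‖(𝓕 (h2.toLp g) : Lp ℂ 2 (volume : Measure V))‖ₑ ^ 2 := by
    rw [← key]
    refine lintegral_congr_ae ?_
    filter_upwards [fourier_toLp_ae_eq h2 h1] with x hx
    rw [hx]
  have e2 : ∫⁻ x, ‖g x‖ₑ ^ 2 = ‖h2.toLp g‖ₑ ^ 2 := by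
    rw [← key]
    refine lintegral_congr_ae ?_
    filter_upwards [h2.coeFn_toLp] with x hx
    rw [hx]
  rw [e1, e2, enorm_eq_nnnorm, enorm_eq_nnnorm]
  congr 2
  exact NNReal.eq (Lp.norm_fourier_eq _)

/-- Fourier transform of the product of a test function with an integrable function. -/
theorem fourier_mul_eq_integral {c G : V → ℂ} (hc : ContDiff ℝ ∞ c) (hcc : HasCompactSupport c)
    (hG : Integrable G volume) (ξ : V) :
    𝓕 (fun x => c x * G x) ξ = ∫ θ, 𝓕 c (-θ) * 𝓕 G (ξ + θ) := by
  let Φ := hcc.toSchwartzMap hc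
  -- The character of frequency `ξ` is absorbed into `G`, which shifts `𝓕 G` by `ξ`; with `c`
  -- written as `𝓕 (𝓕⁻ Φ)`, the multiplication formula gives the convolution.
  have hG' : Integrable (fun x => (Real.fourierChar (-inner ℝ x ξ) : Circle) • G x) volume :=
    (VectorFourier.fourierIntegral_convergent_iff Real.continuous_fourierChar
      (L := innerₗ V) continuous_inner ξ).2 hG
  have e3 := VectorFourier.integral_fourierIntegral_smul_eq_flip (L := innerₗ V)
    Real.continuous_fourierChar continuous_inner ((𝓕⁻ Φ : SchwartzMap V ℂ).integrable (μ := volume)) hG'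
  rw [flip_innerₗ] at e3
  have e4 : VectorFourier.fourierIntegral Real.fourierChar volume (innerₗ V)
      (𝓕⁻ Φ : SchwartzMap V ℂ) = c := by
    have : 𝓕 (𝓕⁻ Φ : SchwartzMap V ℂ) = Φ := FourierTransform.fourier_fourierInv_eq Φ
    have h5 : ⇑(𝓕 (𝓕⁻ Φ : SchwartzMap V ℂ) : SchwartzMap V ℂ) = c := by rw [this]; rfl
    rw [← h5, SchwartzMap.fourier_coe]
    rfl
  rw [e4] at e3
  rw [Real.fourier_eq]
  calc _ = ∫ x, c x • (Real.fourierChar (-inner ℝ x ξ) : Circle) • G x := by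
        refine integral_congr_ae (.of_forall fun x => ?_)
        simp only [Circle.smul_def, smul_eq_mul]
        ring
    _ = _ := e3
    _ = _ := by
        refine integral_congr_ae (.of_forall fun θ => ?_)
        have e6 : (𝓕⁻ Φ : SchwartzMap V ℂ) θ = 𝓕 c (-θ) := by
          rw [SchwartzMap.fourierInv_coe, Real.fourierInv_eq_fourier_neg]
          rfl
        simp only [e6, smul_eq_mul]
        congr 1
        rw [Real.fourier_eq]
        change ∫ x, _ = _
        refine integral_congr_ae (.of_forall fun x => ?_)
        simp only [innerₗ_apply_apply, inner_add_right, neg_add]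
        rw [AddChar.map_add_eq_mul, smul_smul, mul_comm]

end FourierAnalysis

noncomputable section

/-! ### Weights on the frequency side -/

section FrequencyWeights

variable {V : Type*} [NormedAddCommGroup V]

/-- The weight `(1 + |ξ|/k)ʳ`. -/
def freqWeight (k : ℝ) (r : ℕ) (ξ : V) : ℝ≥0∞ := ENNReal.ofReal ((1 + ‖ξ‖ / k) ^ r)

/-- An integrable kernel decaying like `|θ|^{-d-1}`. -/
def decayKernel [NormedSpace ℝ V] (θ : V) : ℝ≥0∞ :=
  ENNReal.ofReal ((1 + ‖θ‖) ^ (-((Module.finrank ℝ V : ℝ) + 1)))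

/-- Averaging of `h` against `decayKernel`. -/
def smear [NormedSpace ℝ V] [MeasureSpace V] (h : V → ℝ≥0∞) (ξ : V) : ℝ≥0∞ :=
  ∫⁻ θ, decayKernel θ * h (ξ + θ)

theorem measurable_freqWeight [MeasurableSpace V] [BorelSpace V] (k : ℝ) (r : ℕ) :
    Measurable (freqWeight k r : V → ℝ≥0∞) := by
  unfold freqWeight; fun_prop

theorem measurable_decayKernel [NormedSpace ℝ V] [MeasurableSpace V] [BorelSpace V] :
    Measurable (decayKernel : V → ℝ≥0∞) := by
  unfold decayKernel; fun_prop

/-- Peetre's inequality. The lower bound `k₀ ≤ k` bounds `‖θ‖ / k` by a multiple of `‖θ‖`, so the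
loss does not depend on `k`. -/
theorem freqWeight_le {k k₀ : ℝ} (hk₀ : 0 < k₀) (hk : k₀ ≤ k) (r : ℕ) (ξ θ : V) :
    freqWeight k r ξ ≤
      ENNReal.ofReal (max 1 k₀⁻¹ ^ r * (1 + ‖θ‖) ^ r) * freqWeight k r (ξ + θ) := by
  have hk' : 0 < k := hk₀.trans_le hk
  unfold freqWeight
  rw [← ENNReal.ofReal_mul (by positivity), ← mul_pow, ← mul_pow]
  refine ENNReal.ofReal_le_ofReal (pow_le_pow_left₀ (by positivity) ?_ r)
  set m := max 1 k₀⁻¹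
  have hm1 : 1 ≤ m := le_max_left _ _
  have hm2 : k⁻¹ ≤ m := (inv_anti₀ hk₀ hk).trans (le_max_right _ _)
  have h1 : ‖ξ‖ ≤ ‖ξ + θ‖ + ‖θ‖ := by
    simpa using norm_sub_le (ξ + θ) θ
  have h2 : ‖ξ‖ / k ≤ ‖ξ + θ‖ / k + ‖θ‖ / k := by
    rw [← add_div]; gcongr
  have h3 : ‖θ‖ / k ≤ m * ‖θ‖ := by
    rw [div_eq_mul_inv, mul_comm]; gcongr
  have h4 : 0 ≤ ‖ξ + θ‖ / k := by positivity
  have h5 : 0 ≤ m * ‖θ‖ := by positivity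
  nlinarith [mul_nonneg h5 h4, mul_nonneg (sub_nonneg.2 hm1) h4]

end FrequencyWeights

/-! ### Convolution with the decaying kernel on `L²` -/

section Young

variable {V : Type*} [NormedAddCommGroup V] [InnerProductSpace ℝ V] [FiniteDimensional ℝ V]
  [MeasurableSpace V] [BorelSpace V]

theorem lintegral_decayKernel_lt_top : ∫⁻ θ : V, decayKernel θ < ⊤ := by
  have := (integrable_one_add_norm (E := V) (μ := volume)
    (r := (Module.finrank ℝ V : ℝ) + 1) (by linarith)).lintegral_lt_top
  exact this

/-- Cauchy–Schwarz for the splitting `P h = √P · (√P h)`. -/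
theorem lintegral_mul_sq_le {α : Type*} [MeasurableSpace α] {μ : Measure α} {P h : α → ℝ≥0∞}
    (hP : Measurable P) (hh : Measurable h) :
    (∫⁻ a, P a * h a ∂μ) ^ 2 ≤ (∫⁻ a, P a ∂μ) * ∫⁻ a, P a * h a ^ 2 ∂μ := by
  have h2 : ∀ a : ℝ≥0∞, (a ^ (1 / 2 : ℝ)) ^ 2 = a := fun a => by
    rw [← ENNReal.rpow_natCast, ← ENNReal.rpow_mul]; norm_num
  have := ENNReal.lintegral_mul_le_Lp_mul_Lq μ (p := 2) (q := 2)
    (Real.HolderConjugate.two_two) (f := fun a => P a ^ (1 / 2 : ℝ))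
    (g := fun a => P a ^ (1 / 2 : ℝ) * h a) (hP.pow_const _).aemeasurable
    ((hP.pow_const _).mul hh).aemeasurable
  calc (∫⁻ a, P a * h a ∂μ) ^ 2
      = (∫⁻ a, ((fun a => P a ^ (1 / 2 : ℝ)) * fun a => P a ^ (1 / 2 : ℝ) * h a) a ∂μ) ^ 2 := by
        congr 1
        refine lintegral_congr fun a => ?_
        rw [Pi.mul_apply, ← mul_assoc, ← sq, h2]
    _ ≤ _ := pow_le_pow_left' this 2
    _ = _ := by
        rw [mul_pow, h2, h2]
        simp only [ENNReal.rpow_ofNat, mul_pow, h2]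

theorem measurable_smear {h : V → ℝ≥0∞} (hh : Measurable h) : Measurable (smear h) := by
  unfold smear
  refine Measurable.lintegral_prod_right' (f := fun p : V × V => decayKernel p.2 * h (p.1 + p.2)) ?_
  exact (measurable_decayKernel.comp measurable_snd).mul (hh.comp measurable_add)

/-- Young's inequality for `smear` on `L²`. -/
theorem lintegral_smear_sq_le {h : V → ℝ≥0∞} (hh : Measurable h) :
    ∫⁻ ξ, smear h ξ ^ 2 ≤ (∫⁻ θ : V, decayKernel θ) ^ 2 * ∫⁻ ξ, h ξ ^ 2 := by
  calc ∫⁻ ξ, smear h ξ ^ 2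
      ≤ ∫⁻ ξ, (∫⁻ θ : V, decayKernel θ) * ∫⁻ θ, decayKernel θ * h (ξ + θ) ^ 2 :=
        lintegral_mono fun ξ => lintegral_mul_sq_le measurable_decayKernel
          (hh.comp (measurable_const_add ξ))
    _ = (∫⁻ θ : V, decayKernel θ) * ∫⁻ ξ, ∫⁻ θ, decayKernel θ * h (ξ + θ) ^ 2 := by
        rw [lintegral_const_mul' _ _ lintegral_decayKernel_lt_top.ne]
    _ = (∫⁻ θ : V, decayKernel θ) * ∫⁻ θ : V, ∫⁻ ξ, decayKernel θ * h (ξ + θ) ^ 2 := by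
        rw [lintegral_lintegral_swap]
        exact ((measurable_decayKernel.comp measurable_snd).mul
          ((hh.comp measurable_add).pow_const 2)).aemeasurable
    _ = (∫⁻ θ : V, decayKernel θ) * ∫⁻ θ : V, decayKernel θ * ∫⁻ ξ, h ξ ^ 2 := by
        congr 1
        refine lintegral_congr fun θ => ?_
        rw [lintegral_const_mul _ (f := fun ξ => h (ξ + θ) ^ 2)
            ((hh.comp (measurable_add_const θ)).pow_const 2),
          lintegral_add_right_eq_self (fun ξ => h ξ ^ 2) θ]
    _ = _ := by
        rw [lintegral_mul_const _ measurable_decayKernel, sq, mul_assoc]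

end Young

/-! ### Multiplication by smooth families of cutoffs -/

section Symbols

variable {V : Type*} [NormedAddCommGroup V] [InnerProductSpace ℝ V]

/-- A smooth family `ν ↦ c ν` of functions supported in `K`. -/
structure IsSymbol (K : Set V) (c : V → V → ℂ) : Prop where
  contDiff : ContDiff ℝ ∞ fun p : V × V => c p.1 p.2
  eq_zero : ∀ ν, ∀ x ∉ K, c ν x = 0

namespace IsSymbol

variable {K : Set V} {c : V → V → ℂ}

theorem contDiff_apply (hc : IsSymbol K c) (ν : V) : ContDiff ℝ ∞ (c ν) :=
  hc.contDiff.comp (contDiff_const.prodMk contDiff_id)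

theorem hasCompactSupport (hc : IsSymbol K c) (hK : IsCompact K) (ν : V) :
    HasCompactSupport (c ν) :=
  HasCompactSupport.intro hK fun x hx => hc.eq_zero ν x hx

theorem iteratedFDeriv_eq_zero (hc : IsSymbol K c) (hK : IsClosed K) (ν : V) (m : ℕ) {x : V}
    (hx : x ∉ K) : iteratedFDeriv ℝ m (c ν) x = 0 := by
  have h : c ν =ᶠ[nhds x] 0 := by
    filter_upwards [hK.isOpen_compl.mem_nhds hx] with y hy
    exact hc.eq_zero ν y hy
  rw [(h.iteratedFDeriv ℝ m).eq_of_nhds]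
  simp

/-- Joint smoothness bounds the derivatives on the compact set `sphere × K`. The derivatives in `x`
alone come from restricting to the slice at `ν`, a translate of `ContinuousLinearMap.inr`, whence
the factor `‖inr‖ ^ m`. -/
theorem exists_bound_iteratedFDeriv [FiniteDimensional ℝ V] (hc : IsSymbol K c)
    (hK : IsCompact K) (m : ℕ) :
    ∃ B : ℝ, 0 ≤ B ∧ ∀ ν, ‖ν‖ = 1 → ∀ x, ‖iteratedFDeriv ℝ m (c ν) x‖ ≤ B := by
  have hcont : Continuous fun p : V × V => iteratedFDeriv ℝ m (fun p : V × V => c p.1 p.2) p :=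
    hc.contDiff.continuous_iteratedFDeriv (by exact_mod_cast le_top)
  obtain ⟨B, hB⟩ := ((isCompact_sphere (0 : V) 1).prod hK).exists_bound_of_continuousOn
    hcont.continuousOn
  refine ⟨max B 0 * ‖ContinuousLinearMap.inr ℝ V V‖ ^ m, by positivity, fun ν hν x => ?_⟩
  by_cases hx : x ∈ K
  · have e : c ν = ((fun p : V × V => c p.1 p.2) ∘ fun p => p + (ν, 0)) ∘
        ContinuousLinearMap.inr ℝ V V := by
      funext y; simp
    have hs : ContDiff ℝ ∞ ((fun p : V × V => c p.1 p.2) ∘ fun p => p + (ν, 0)) :=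
      hc.contDiff.comp (contDiff_id.add contDiff_const)
    rw [e, ContinuousLinearMap.iteratedFDeriv_comp_right _ hs x (i := m) (by exact_mod_cast le_top)]
    refine (ContinuousMultilinearMap.norm_compContinuousLinearMap_le _ _).trans ?_
    rw [Finset.prod_const, Finset.card_univ, Fintype.card_fin]
    gcongr
    have := iteratedFDeriv_comp_add_right (𝕜 := ℝ) (f := fun p : V × V => c p.1 p.2) m (ν, 0)
      (ContinuousLinearMap.inr ℝ V V x)
    change ‖iteratedFDeriv ℝ m (fun z => (fun p : V × V => c p.1 p.2) (z + (ν, 0))) _‖ ≤ _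
    rw [this]
    refine (hB _ ⟨?_, ?_⟩).trans (le_max_left _ _)
    · simpa using hν
    · simpa using hx
  · rw [hc.iteratedFDeriv_eq_zero hK.isClosed ν m hx, norm_zero]
    positivity

variable [FiniteDimensional ℝ V] [MeasurableSpace V] [BorelSpace V]

/-- `N` integrations by parts: only the `L¹` norms of derivatives in `x` enter, and these are
uniform over unit `ν`. -/
theorem exists_norm_fourier_le (hc : IsSymbol K c) (hK : IsCompact K) (N : ℕ) :
    ∃ D : ℝ, 0 ≤ D ∧ ∀ ν, ‖ν‖ = 1 → ∀ θ, ‖θ‖ ^ N * ‖𝓕 (c ν) θ‖ ≤ D := by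
  choose B hB0 hB using fun m => hc.exists_bound_iteratedFDeriv hK m
  refine ⟨2 ^ N * ∑ p ∈ Finset.range (N + 1), B p * volume.real K, ?_, fun ν hν θ => ?_⟩
  · exact mul_nonneg (by positivity)
      (Finset.sum_nonneg fun p _ => mul_nonneg (hB0 p) measureReal_nonneg)
  have hint : ∀ p : ℕ, Integrable (iteratedFDeriv ℝ p (c ν)) := fun p =>
    ((hc.contDiff_apply ν).continuous_iteratedFDeriv (by exact_mod_cast le_top)
      ).integrable_of_hasCompactSupport ((hc.hasCompactSupport hK ν).iteratedFDeriv p)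
  have h := Real.pow_mul_norm_iteratedFDeriv_fourier_le (K := 0) (N := ⊤) (k := 0) (n := N)
    (hc.contDiff_apply ν) (fun k n hk _ => by
      have : k = 0 := by exact_mod_cast le_antisymm hk bot_le
      subst this
      simpa using (hint n).norm) (by simp) le_top θ
  simp only [norm_iteratedFDeriv_zero, pow_zero, one_mul, zero_add, Finset.range_one,
    Nat.cast_zero, mul_zero] at h
  refine h.trans ?_
  rw [Finset.sum_product]
  simp only [Finset.sum_singleton, pow_zero, one_mul]
  gcongr with p hp
  have h0 : ∀ x ∉ K, ‖iteratedFDeriv ℝ p (c ν) x‖ = 0 := fun x hx => by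
    rw [hc.iteratedFDeriv_eq_zero hK.isClosed ν p hx, norm_zero]
  rw [← setIntegral_eq_integral_of_forall_compl_eq_zero h0]
  calc ∫ x in K, ‖iteratedFDeriv ℝ p (c ν) x‖ ≤ ∫ x in K, B p :=
        setIntegral_mono (hint p).norm.integrableOn
          (integrableOn_const hK.measure_lt_top.ne) (hB p ν hν)
    _ = _ := by rw [setIntegral_const, smul_eq_mul, mul_comm]

/-- Multiplication by a symbol, evaluated at frequency `ξ`, is bounded by `smear`, uniformly in
the parameter on the unit sphere. -/
theorem exists_freqWeight_mul_fourier_le (hc : IsSymbol K c) (hK : IsCompact K) (r : ℕ) {k₀ : ℝ}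
    (hk₀ : 0 < k₀) :
    ∃ D : ℝ, 0 ≤ D ∧ ∀ k, k₀ ≤ k → ∀ ν, ‖ν‖ = 1 → ∀ G : V → ℂ, Integrable G volume → ∀ ξ,
      freqWeight k r ξ * ‖𝓕 (fun x => c ν x * G x) ξ‖ₑ ≤
        ENNReal.ofReal D * smear (fun η => freqWeight k r η * ‖𝓕 G η‖ₑ) ξ := by
  -- `r` powers of decay pay for Peetre's inequality, and the remaining `dim + 1` leave the
  -- integrable kernel.
  set N := r + (Module.finrank ℝ V + 1) with hN
  obtain ⟨D₀, hD₀, h0⟩ := hc.exists_norm_fourier_le hK 0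
  obtain ⟨D₁, hD₁, h1⟩ := hc.exists_norm_fourier_le hK N
  set D := 2 ^ N * (D₀ + D₁) with hD
  have hdecay : ∀ ν, ‖ν‖ = 1 → ∀ θ, (1 + ‖θ‖) ^ N * ‖𝓕 (c ν) θ‖ ≤ D := by
    intro ν hν θ
    have a := h0 ν hν θ
    have b := h1 ν hν θ
    rw [pow_zero, one_mul] at a
    have : (1 + ‖θ‖) ^ N ≤ 2 ^ N * (1 + ‖θ‖ ^ N) := by
      have := add_pow_le (zero_le_one (α := ℝ)) (norm_nonneg θ) N
      rw [one_pow] at this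
      refine this.trans ?_
      gcongr
      · norm_num
      · omega
    calc (1 + ‖θ‖) ^ N * ‖𝓕 (c ν) θ‖ ≤ 2 ^ N * (1 + ‖θ‖ ^ N) * ‖𝓕 (c ν) θ‖ := by gcongr
      _ = 2 ^ N * (‖𝓕 (c ν) θ‖ + ‖θ‖ ^ N * ‖𝓕 (c ν) θ‖) := by ring
      _ ≤ D := by rw [hD]; gcongr
  set m := max 1 k₀⁻¹ with hm
  have hD0 : 0 ≤ D := by positivity
  refine ⟨m ^ r * D, by positivity, fun k hk ν hν G hG ξ => ?_⟩
  rw [fourier_mul_eq_integral (hc.contDiff_apply ν) (hc.hasCompactSupport hK ν) hG]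
  calc freqWeight k r ξ * ‖∫ θ, 𝓕 (c ν) (-θ) * 𝓕 G (ξ + θ)‖ₑ
      ≤ freqWeight k r ξ * ∫⁻ θ, ‖𝓕 (c ν) (-θ) * 𝓕 G (ξ + θ)‖ₑ := by
        gcongr; exact enorm_integral_le_lintegral_enorm _
    _ = ∫⁻ θ, freqWeight k r ξ * ‖𝓕 (c ν) (-θ) * 𝓕 G (ξ + θ)‖ₑ := by
        rw [lintegral_const_mul' (freqWeight k r ξ) _ ENNReal.ofReal_ne_top]
    _ ≤ ∫⁻ θ, ENNReal.ofReal (m ^ r * D) *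
          (decayKernel θ * (freqWeight k r (ξ + θ) * ‖𝓕 G (ξ + θ)‖ₑ)) := by
        refine lintegral_mono fun θ => ?_
        have hF : ‖𝓕 (c ν) (-θ)‖ₑ * ENNReal.ofReal ((1 + ‖θ‖) ^ r) ≤
            ENNReal.ofReal D * decayKernel θ := by
          unfold decayKernel
          rw [← ofReal_norm, ← ENNReal.ofReal_mul (norm_nonneg _),
            ← ENNReal.ofReal_mul hD0]
          refine ENNReal.ofReal_le_ofReal ?_
          have := hdecay ν hν (-θ)
          rw [norm_neg, hN, pow_add] at this
          have hp : 0 < (1 + ‖θ‖) ^ (Module.finrank ℝ V + 1) := by positivity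
          rw [Real.rpow_neg (by positivity)]
          have e : ((1 : ℝ) + ‖θ‖) ^ ((Module.finrank ℝ V : ℝ) + 1) =
              (1 + ‖θ‖) ^ (Module.finrank ℝ V + 1) := by
            rw [← Real.rpow_natCast]; push_cast; rfl
          rw [e, ← div_eq_mul_inv, le_div_iff₀ hp]
          linarith
        calc freqWeight k r ξ * ‖𝓕 (c ν) (-θ) * 𝓕 G (ξ + θ)‖ₑ
            ≤ ENNReal.ofReal (m ^ r * (1 + ‖θ‖) ^ r) * freqWeight k r (ξ + θ) *
              ‖𝓕 (c ν) (-θ) * 𝓕 G (ξ + θ)‖ₑ := by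
              gcongr; exact freqWeight_le hk₀ hk r ξ θ
          _ = ENNReal.ofReal (m ^ r) * (‖𝓕 (c ν) (-θ)‖ₑ * ENNReal.ofReal ((1 + ‖θ‖) ^ r)) *
              (freqWeight k r (ξ + θ) * ‖𝓕 G (ξ + θ)‖ₑ) := by
              rw [enorm_mul, ENNReal.ofReal_mul (by positivity)]; ring
          _ ≤ ENNReal.ofReal (m ^ r) * (ENNReal.ofReal D * decayKernel θ) *
              (freqWeight k r (ξ + θ) * ‖𝓕 G (ξ + θ)‖ₑ) := by gcongr
          _ = _ := by rw [ENNReal.ofReal_mul (p := m ^ r) (by positivity)]; ring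
    _ = _ := by
        rw [lintegral_const_mul' _ _ ENNReal.ofReal_ne_top]; rfl

end IsSymbol

end Symbols

end

noncomputable section

/-! ### Rules for partial derivatives -/

section PartialDerivatives

variable {n : ℕ} {F : Type*} [NormedAddCommGroup F] [NormedSpace ℝ F]

theorem ContDiffOn.partialDeriv {U : Set (EuclideanSpace ℝ (Fin n))} (hU : IsOpen U)
    {φ : EuclideanSpace ℝ (Fin n) → F} (hφ : ContDiffOn ℝ ∞ φ U) (i : Fin n) :
    ContDiffOn ℝ ∞ (partialDeriv i φ) U :=
  (hφ.fderiv_of_isOpen hU (m := ∞) (by simp)).clm_apply contDiffOn_const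

theorem ContDiff.partialDeriv {φ : EuclideanSpace ℝ (Fin n) → F} (hφ : ContDiff ℝ ∞ φ)
    (i : Fin n) : ContDiff ℝ ∞ (partialDeriv i φ) :=
  (hφ.fderiv_right (m := ∞) (by simp)).clm_apply contDiff_const

theorem partialDeriv_eq_zero_of_notMem {K : Set (EuclideanSpace ℝ (Fin n))} (hK : IsClosed K)
    {φ : EuclideanSpace ℝ (Fin n) → F} (h : ∀ x ∉ K, φ x = 0) (i : Fin n)
    {x : EuclideanSpace ℝ (Fin n)} (hx : x ∉ K) : partialDeriv i φ x = 0 := by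
  have : φ =ᶠ[nhds x] fun _ => 0 := by
    filter_upwards [hK.isOpen_compl.mem_nhds hx] with y hy using h y hy
  rw [partialDeriv, this.fderiv_eq]
  simp

theorem partialDeriv_add {φ φ' : EuclideanSpace ℝ (Fin n) → F} {x : EuclideanSpace ℝ (Fin n)}
    (h : DifferentiableAt ℝ φ x) (h' : DifferentiableAt ℝ φ' x) (i : Fin n) :
    partialDeriv i (fun y => φ y + φ' y) x =
      partialDeriv i φ x + partialDeriv i φ' x := by
  simp only [partialDeriv]
  rw [fderiv_fun_add h h']
  rfl

theorem partialDeriv_mul {φ φ' : EuclideanSpace ℝ (Fin n) → ℂ} {x : EuclideanSpace ℝ (Fin n)}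
    (h : DifferentiableAt ℝ φ x) (h' : DifferentiableAt ℝ φ' x) (i : Fin n) :
    partialDeriv i (fun y => φ y * φ' y) x =
      partialDeriv i φ x * φ' x + φ x * partialDeriv i φ' x := by
  simp only [partialDeriv]
  rw [fderiv_fun_mul h h']
  simp only [add_apply, smul_apply, smul_eq_mul]
  ring

theorem partialDeriv_const_mul {φ : EuclideanSpace ℝ (Fin n) → ℂ} {x : EuclideanSpace ℝ (Fin n)}
    (h : DifferentiableAt ℝ φ x) (c : ℂ) (i : Fin n) :
    partialDeriv i (fun y => c * φ y) x = c * partialDeriv i φ x := by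
  simp only [partialDeriv]
  rw [fderiv_const_mul h]
  rfl

theorem partialDeriv_ofReal {φ : EuclideanSpace ℝ (Fin n) → ℝ} {x : EuclideanSpace ℝ (Fin n)}
    (h : DifferentiableAt ℝ φ x) (i : Fin n) :
    partialDeriv i (fun y => (φ y : ℂ)) x = ((partialDeriv i φ x : ℝ) : ℂ) := by
  have := (Complex.ofRealCLM.hasFDerivAt.comp x h.hasFDerivAt).fderiv
  simp only [partialDeriv]
  change fderiv ℝ (Complex.ofRealCLM ∘ φ) x _ = _
  rw [this]
  rfl

end PartialDerivatives

/-! ### The metric in a chart: smoothness and ellipticity -/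

namespace SurfaceChart

variable {n : ℕ} {Γ : Set (EuclideanSpace ℝ (Fin (n + 1)))} (κ : SurfaceChart Γ)

theorem mapsTo_param : Set.MapsTo κ.param κ.source Γ := by
  intro x hx
  obtain ⟨U, -, hU⟩ := κ.isOpen_image κ.source subset_rfl κ.isOpen_source
  have : κ.param x ∈ Γ ∩ U := hU ▸ Set.mem_image_of_mem _ hx
  exact this.1

theorem posDef_gram {x : EuclideanSpace ℝ (Fin n)} (hx : x ∈ κ.source) :
    (κ.gram x).PosDef := by
  have hli : LinearIndependent ℝ fun i => partialDeriv i κ.param x := by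
    have h1 := (EuclideanSpace.basisFun (Fin n) ℝ).toBasis.linearIndependent
    have h2 := h1.map' (fderiv ℝ κ.param x).toLinearMap
      (LinearMap.ker_eq_bot.2 (κ.injective_fderiv x hx))
    have e : (fun i => partialDeriv i κ.param x) =
        (fderiv ℝ κ.param x).toLinearMap ∘ (EuclideanSpace.basisFun (Fin n) ℝ).toBasis := by
      funext i
      simp [partialDeriv]
    rw [e]
    exact h2
  exact Matrix.posDef_gram_of_linearIndependent hli

theorem density_pos {x : EuclideanSpace ℝ (Fin n)} (hx : x ∈ κ.source) : 0 < κ.density x :=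
  Real.sqrt_pos.2 (κ.posDef_gram hx).det_pos

/-- The coefficients `√(det g) gⁱʲ` of the Laplace–Beltrami operator in divergence form. -/
def metricCoeff (i j : Fin n) (x : EuclideanSpace ℝ (Fin n)) : ℝ :=
  κ.density x * (κ.gram x)⁻¹ i j

theorem contDiffOn_gram (i j : Fin n) : ContDiffOn ℝ ∞ (fun x => κ.gram x i j) κ.source :=
  (κ.contDiffOn_param.partialDeriv κ.isOpen_source i).inner ℝ
    (κ.contDiffOn_param.partialDeriv κ.isOpen_source j)

theorem contDiffOn_det {M : EuclideanSpace ℝ (Fin n) → Matrix (Fin n) (Fin n) ℝ}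
    {U : Set (EuclideanSpace ℝ (Fin n))}
    (hM : ∀ i j, ContDiffOn ℝ ∞ (fun x => M x i j) U) :
    ContDiffOn ℝ ∞ (fun x => (M x).det) U := by
  simp only [Matrix.det_apply]
  refine ContDiffOn.sum fun σ _ => ?_
  exact (contDiffOn_prod fun i _ => hM _ _).const_smul _

theorem contDiffOn_density : ContDiffOn ℝ ∞ κ.density κ.source :=
  (contDiffOn_det κ.contDiffOn_gram).sqrt fun _ hx => (κ.posDef_gram hx).det_pos.ne'

/-- Cramer's rule: the inverse matrix is the adjugate, polynomial in the entries, divided by a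
nonvanishing determinant. -/
theorem contDiffOn_metricCoeff (i j : Fin n) : ContDiffOn ℝ ∞ (κ.metricCoeff i j) κ.source := by
  refine κ.contDiffOn_density.mul ?_
  have e : Set.EqOn (fun x => (κ.gram x)⁻¹ i j)
      (fun x => (κ.gram x).det⁻¹ * (κ.gram x).adjugate i j) κ.source := fun x _ => by
    simp [Matrix.inv_def]
  refine ContDiffOn.congr ?_ e
  refine ((contDiffOn_det κ.contDiffOn_gram).inv fun x hx => (κ.posDef_gram hx).det_pos.ne').mul ?_
  simp only [Matrix.adjugate_apply]
  refine contDiffOn_det fun i' j' => ?_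
  simp only [Matrix.updateRow_apply]
  split_ifs
  · exact contDiffOn_const
  · exact κ.contDiffOn_gram _ _

theorem sum_metricCoeff_pos {x : EuclideanSpace ℝ (Fin n)} (hx : x ∈ κ.source)
    {v : EuclideanSpace ℝ (Fin n)} (hv : v ≠ 0) :
    0 < ∑ i, ∑ j, κ.metricCoeff i j x * v i * v j := by
  have h := (κ.posDef_gram hx).inv.dotProduct_mulVec_pos (x := v.ofLp) (by simpa using hv)
  have e : ∑ i, ∑ j, κ.metricCoeff i j x * v i * v j =
      κ.density x * (star v.ofLp ⬝ᵥ ((κ.gram x)⁻¹.mulVec v.ofLp)) := by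
    simp only [dotProduct, Matrix.mulVec, Finset.mul_sum, metricCoeff, Pi.star_apply, star_trivial]
    refine Finset.sum_congr rfl fun i _ => Finset.sum_congr rfl fun j _ => ?_
    ring
  rw [e]
  exact mul_pos (κ.density_pos hx) h

end SurfaceChart

end

noncomputable section

/-! ### Operations preserving symbols -/

section SymbolCalculus

namespace IsSymbol

theorem of_contDiffOn {V : Type*} [NormedAddCommGroup V] [InnerProductSpace ℝ V] {K U : Set V}
    (hU : IsOpen U) (hK : IsClosed K) (hKU : K ⊆ U) {c : V → V → ℂ}
    (hc : ContDiffOn ℝ ∞ (fun p : V × V => c p.1 p.2) (Set.univ ×ˢ U))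
    (h0 : ∀ ν, ∀ x ∉ K, c ν x = 0) : IsSymbol K c := by
  refine ⟨contDiff_iff_contDiffAt.2 fun p => ?_, h0⟩
  by_cases hp : p.2 ∈ K
  · exact hc.contDiffAt ((isOpen_univ.prod hU).mem_nhds ⟨trivial, hKU hp⟩)
  · have : (fun p : V × V => c p.1 p.2) =ᶠ[nhds p] fun _ => 0 := by
      filter_upwards [(hK.isOpen_compl.preimage continuous_snd).mem_nhds hp] with y hy
      exact h0 _ _ hy
    exact contDiffAt_const.congr_of_eventuallyEq this

variable {n : ℕ} {K U : Set (EuclideanSpace ℝ (Fin n))}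
  {c : EuclideanSpace ℝ (Fin n) → EuclideanSpace ℝ (Fin n) → ℂ}

theorem coeff_mul (hU : IsOpen U) (hK : IsClosed K) (hKU : K ⊆ U) (hc : IsSymbol K c)
    {b : EuclideanSpace ℝ (Fin n) → ℝ} (hb : ContDiffOn ℝ ∞ b U) :
    IsSymbol K fun ν x => (b x : ℂ) * c ν x := by
  refine of_contDiffOn hU hK hKU ?_ fun ν x hx => by rw [hc.eq_zero ν x hx, mul_zero]
  refine ContDiffOn.mul ?_ hc.contDiff.contDiffOn
  exact Complex.ofRealCLM.contDiff.comp_contDiffOn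
    (hb.comp contDiff_snd.contDiffOn fun p hp => hp.2)

theorem param_mul (hc : IsSymbol K c) {b : EuclideanSpace ℝ (Fin n) → ℂ} (hb : ContDiff ℝ ∞ b) :
    IsSymbol K fun ν x => b ν * c ν x :=
  ⟨(hb.comp contDiff_fst).mul hc.contDiff, fun ν x hx => by rw [hc.eq_zero ν x hx, mul_zero]⟩

theorem add {c' : EuclideanSpace ℝ (Fin n) → EuclideanSpace ℝ (Fin n) → ℂ}
    (hc : IsSymbol K c) (hc' : IsSymbol K c') : IsSymbol K fun ν x => c ν x + c' ν x :=
  ⟨hc.contDiff.add hc'.contDiff, fun ν x hx => by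
    rw [hc.eq_zero ν x hx, hc'.eq_zero ν x hx, add_zero]⟩

theorem sum {ι : Type*} {s : Finset ι}
    {c : ι → EuclideanSpace ℝ (Fin n) → EuclideanSpace ℝ (Fin n) → ℂ}
    (hc : ∀ i ∈ s, IsSymbol K (c i)) : IsSymbol K fun ν x => ∑ i ∈ s, c i ν x :=
  ⟨ContDiff.sum fun i hi => (hc i hi).contDiff, fun ν x hx =>
    Finset.sum_eq_zero fun i hi => (hc i hi).eq_zero ν x hx⟩

/-- The derivative in `x` is the derivative of the joint map in the direction `(0, eᵢ)`, so
smoothness in `ν` is kept. -/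
theorem deriv (hK : IsClosed K) (hc : IsSymbol K c) (i : Fin n) :
    IsSymbol K fun ν x => partialDeriv i (c ν) x := by
  refine ⟨?_, fun ν x hx => partialDeriv_eq_zero_of_notMem hK (hc.eq_zero ν) i hx⟩
  have e : (fun p : EuclideanSpace ℝ (Fin n) × EuclideanSpace ℝ (Fin n) =>
      partialDeriv i (c p.1) p.2) = fun p =>
      fderiv ℝ (fun p : EuclideanSpace ℝ (Fin n) × EuclideanSpace ℝ (Fin n) => c p.1 p.2) p
        (0, EuclideanSpace.single i 1) := by
    funext p
    have h1 : DifferentiableAt ℝ (fun p : EuclideanSpace ℝ (Fin n) × EuclideanSpace ℝ (Fin n) =>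
      c p.1 p.2) (p.1, p.2) := hc.contDiff.contDiffAt.differentiableAt (by simp)
    have h2 := h1.hasFDerivAt.comp p.2
      ((hasFDerivAt_const p.1 p.2).prodMk (hasFDerivAt_id p.2))
    have h3 : fderiv ℝ (c p.1) p.2 = _ := h2.fderiv
    rw [partialDeriv, h3]
    simp
  rw [e]
  exact (hc.contDiff.fderiv_right (m := ∞) (by simp)).clm_apply contDiff_const

end IsSymbol

end SymbolCalculus

/-! ### Conjugating a divergence-form operator by plane waves -/

section DivergenceForm

variable {n : ℕ}

/-- The second-order operator `ψ ↦ ∑ᵢ ∂ᵢ (∑ⱼ aᵢⱼ ∂ⱼ ψ)`. -/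
def divForm (a : Fin n → Fin n → EuclideanSpace ℝ (Fin n) → ℝ)
    (ψ : EuclideanSpace ℝ (Fin n) → ℂ) (x : EuclideanSpace ℝ (Fin n)) : ℂ :=
  ∑ i, partialDeriv i (fun y => ∑ j, (a i j y : ℂ) * partialDeriv j ψ y) x

/-- The first-order part of the conjugate of `divForm a` by the exponentials `e^{-2πi t x·ν}`. -/
def divFormCross (a : Fin n → Fin n → EuclideanSpace ℝ (Fin n) → ℝ)
    (ν : EuclideanSpace ℝ (Fin n)) (q : EuclideanSpace ℝ (Fin n) → ℂ)
    (x : EuclideanSpace ℝ (Fin n)) : ℂ :=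
  ∑ i, (partialDeriv i
      (fun y => ∑ j, (-(2 * Real.pi * Complex.I) * (ν j : ℂ)) * ((a i j y : ℂ) * q y)) x +
    (-(2 * Real.pi * Complex.I) * (ν i : ℂ)) * ∑ j, (a i j x : ℂ) * partialDeriv j q x)

/-- The wave `e^{-2πi x·ξ}`. -/
def wave (ξ x : EuclideanSpace ℝ (Fin n)) : ℂ :=
  Complex.exp ((↑(-2 * Real.pi * inner ℝ x ξ) : ℂ) * Complex.I)

theorem contDiff_wave (ξ : EuclideanSpace ℝ (Fin n)) : ContDiff ℝ ∞ (wave ξ) := by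
  unfold wave
  refine ContDiff.cexp (ContDiff.mul ?_ contDiff_const)
  exact Complex.ofRealCLM.contDiff.comp (contDiff_const.mul (contDiff_id.inner ℝ contDiff_const))

theorem partialDeriv_wave (t : ℝ) (ν : EuclideanSpace ℝ (Fin n)) (j : Fin n)
    (x : EuclideanSpace ℝ (Fin n)) :
    partialDeriv j (wave (t • ν)) x =
      t * (-(2 * Real.pi * Complex.I) * (ν j : ℂ)) * wave (t • ν) x := by
  have h0 : HasFDerivAt (fun y : EuclideanSpace ℝ (Fin n) => inner ℝ y (t • ν))
      (innerSL ℝ (t • ν)) x := by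
    have := (innerSL ℝ (t • ν)).hasFDerivAt (x := x)
    refine this.congr_of_eventuallyEq (.of_forall fun y => ?_)
    rw [innerSL_apply_apply, real_inner_comm]
  have h1 := Complex.ofRealCLM.hasFDerivAt.comp x (h0.const_mul (-2 * Real.pi))
  have h2 := (h1.mul_const Complex.I).cexp
  have h3 : fderiv ℝ (wave (t • ν)) x = _ := h2.fderiv
  rw [partialDeriv, h3]
  simp [wave, EuclideanSpace.inner_single_right]
  ring

variable {U : Set (EuclideanSpace ℝ (Fin n))}
  {a : Fin n → Fin n → EuclideanSpace ℝ (Fin n) → ℝ}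

theorem differentiableAt_coeff (hU : IsOpen U) (ha : ∀ i j, ContDiffOn ℝ ∞ (a i j) U)
    {x : EuclideanSpace ℝ (Fin n)} (hx : x ∈ U) (i j : Fin n) :
    DifferentiableAt ℝ (fun y => (a i j y : ℂ)) x :=
  Complex.ofRealCLM.differentiableAt.comp x
    (((ha i j).contDiffAt (hU.mem_nhds hx)).differentiableAt (by simp))

/-- By Leibniz, each derivative falling on the wave produces `-2πi t νⱼ`. Collecting powers of `t`,
the coefficient of `t²` is `(-2πi)² = -4π²` times the principal symbol. -/
theorem divForm_mul_wave (hU : IsOpen U) (ha : ∀ i j, ContDiffOn ℝ ∞ (a i j) U)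
    {q : EuclideanSpace ℝ (Fin n) → ℂ} (hq : ContDiff ℝ ∞ q) (t : ℝ)
    (ν : EuclideanSpace ℝ (Fin n)) {x : EuclideanSpace ℝ (Fin n)} (hx : x ∈ U) :
    divForm a (fun y => q y * wave (t • ν) y) x =
      wave (t • ν) x * (divForm a q x + t * divFormCross a ν q x -
        4 * Real.pi ^ 2 * t ^ 2 * ((∑ i, ∑ j, a i j x * ν i * ν j : ℝ) * q x)) := by
  have hqd : ∀ y, DifferentiableAt ℝ q y := fun y => hq.contDiffAt.differentiableAt (by simp)
  have hwd : ∀ y, DifferentiableAt ℝ (wave (t • ν)) y := fun y =>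
    (contDiff_wave _).contDiffAt.differentiableAt (by simp)
  have had := differentiableAt_coeff hU ha hx
  set p : Fin n → EuclideanSpace ℝ (Fin n) → ℂ :=
    fun i y => ∑ j, (a i j y : ℂ) * partialDeriv j q y with hp
  set s : Fin n → EuclideanSpace ℝ (Fin n) → ℂ :=
    fun i y => ∑ j, (-(2 * Real.pi * Complex.I) * (ν j : ℂ)) * ((a i j y : ℂ) * q y) with hs
  have hpd : ∀ i, DifferentiableAt ℝ (p i) x := fun i =>
    DifferentiableAt.fun_sum fun j _ => (had i j).mul
      ((hq.partialDeriv j).contDiffAt.differentiableAt (by simp))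
  have hsd : ∀ i, DifferentiableAt ℝ (s i) x := fun i =>
    DifferentiableAt.fun_sum fun j _ => ((had i j).mul (hqd x)).const_mul _
  have e1 : ∀ i, (fun y => ∑ j, (a i j y : ℂ) *
      partialDeriv j (fun y => q y * wave (t • ν) y) y) =
      fun y => (p i y + t * s i y) * wave (t • ν) y := by
    intro i
    funext y
    simp only [hp, hs, Finset.mul_sum, ← Finset.sum_add_distrib, Finset.sum_mul]
    refine Finset.sum_congr rfl fun j _ => ?_
    rw [partialDeriv_mul (hqd y) (hwd y), partialDeriv_wave]
    ring
  have e2 : ∀ i, partialDeriv i (fun y => (p i y + t * s i y) * wave (t • ν) y) x =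
      wave (t • ν) x * (partialDeriv i (p i) x + t * (partialDeriv i (s i) x +
        (-(2 * Real.pi * Complex.I) * (ν i : ℂ)) * p i x) +
        t ^ 2 * ((-(2 * Real.pi * Complex.I) * (ν i : ℂ)) * s i x)) := by
    intro i
    rw [partialDeriv_mul ((hpd i).fun_add ((hsd i).const_mul _)) (hwd x),
      partialDeriv_add (hpd i) ((hsd i).const_mul _), partialDeriv_const_mul (hsd i),
      partialDeriv_wave]
    ring
  have e3 : ∑ i, (-(2 * Real.pi * Complex.I) * (ν i : ℂ)) * s i x =
      -(4 * Real.pi ^ 2) * ((∑ i, ∑ j, a i j x * ν i * ν j : ℝ) * q x) := by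
    simp only [hs]
    push_cast
    simp only [Finset.mul_sum, Finset.sum_mul]
    refine Finset.sum_congr rfl fun i _ => Finset.sum_congr rfl fun j _ => ?_
    linear_combination (4 * Real.pi ^ 2 * (a i j x : ℂ) * ν i * ν j * q x) * Complex.I_sq
  unfold divForm divFormCross
  simp only [e1, e2, ← Finset.mul_sum, Finset.sum_add_distrib]
  rw [e3]
  simp only [hp, hs]
  ring

/-- The amplitude `χ / a(x, ν)` inverting the principal symbol on the unit sphere. -/
def inverseSymbol (a : Fin n → Fin n → EuclideanSpace ℝ (Fin n) → ℝ)
    (χ : EuclideanSpace ℝ (Fin n) → ℂ) (ν x : EuclideanSpace ℝ (Fin n)) : ℂ :=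
  (((∑ i, ∑ j, a i j x * ν i * ν j) + (1 - ‖ν‖ ^ 2) ^ 2)⁻¹ : ℝ) * χ x

/-- The term `(1 - ‖ν‖²)²` in the denominator is 0 on the unit sphere and 1 at `ν = 0`. The
denominator is thus positive for all `ν`, and the family is smooth in `ν` on the whole space while
remaining the exact inverse on the sphere. -/
theorem isSymbol_inverseSymbol (hU : IsOpen U) (ha : ∀ i j, ContDiffOn ℝ ∞ (a i j) U)
    (hell : ∀ x ∈ U, ∀ v : EuclideanSpace ℝ (Fin n), v ≠ 0 → 0 < ∑ i, ∑ j, a i j x * v i * v j)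
    {χ : EuclideanSpace ℝ (Fin n) → ℂ} (hχ : ContDiff ℝ ∞ χ) (hχU : tsupport χ ⊆ U) :
    IsSymbol (tsupport χ) (inverseSymbol a χ) := by
  refine IsSymbol.of_contDiffOn hU (isClosed_tsupport χ) hχU ?_ fun ν x hx => by
    rw [inverseSymbol, image_eq_zero_of_notMem_tsupport hx, mul_zero]
  unfold inverseSymbol
  refine ContDiffOn.mul ?_ (hχ.comp contDiff_snd).contDiffOn
  refine Complex.ofRealCLM.contDiff.comp_contDiffOn (ContDiffOn.inv ?_ ?_)
  · refine ContDiffOn.add ?_ ?_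
    · refine ContDiffOn.sum fun i _ => ContDiffOn.sum fun j _ => ?_
      have hc : ∀ i : Fin n, ContDiff ℝ ∞
          fun p : EuclideanSpace ℝ (Fin n) × EuclideanSpace ℝ (Fin n) => p.1 i := fun i =>
        (EuclideanSpace.proj (𝕜 := ℝ) i).contDiff.comp contDiff_fst
      exact (((ha i j).comp contDiff_snd.contDiffOn fun p hp => hp.2).mul
        (hc i).contDiffOn).mul (hc j).contDiffOn
    · exact ((contDiff_const.sub (contDiff_fst.norm_sq ℝ)).pow 2).contDiffOn
  · rintro ⟨ν, x⟩ ⟨-, hx⟩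
    by_cases hν : ν = 0
    · subst hν
      simp
    · have := hell x hx ν hν
      simp only
      positivity

theorem principal_mul_inverseSymbol
    (hell : ∀ x ∈ U, ∀ v : EuclideanSpace ℝ (Fin n), v ≠ 0 → 0 < ∑ i, ∑ j, a i j x * v i * v j)
    (χ : EuclideanSpace ℝ (Fin n) → ℂ) {ν x : EuclideanSpace ℝ (Fin n)} (hν : ‖ν‖ = 1)
    (hx : x ∈ U) :
    (∑ i, ∑ j, a i j x * ν i * ν j : ℝ) * inverseSymbol a χ ν x = χ x := by
  have h := hell x hx ν (by rintro rfl; simp at hν)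
  rw [inverseSymbol, hν, ← mul_assoc, ← Complex.ofReal_mul, one_pow, sub_self,
    zero_pow two_ne_zero, add_zero, mul_inv_cancel₀ h.ne', Complex.ofReal_one, one_mul]

theorem isSymbol_divForm (hU : IsOpen U) (ha : ∀ i j, ContDiffOn ℝ ∞ (a i j) U)
    {K : Set (EuclideanSpace ℝ (Fin n))} (hK : IsClosed K) (hKU : K ⊆ U)
    {q : EuclideanSpace ℝ (Fin n) → EuclideanSpace ℝ (Fin n) → ℂ} (hq : IsSymbol K q) :
    IsSymbol K fun ν => divForm a (q ν) :=
  IsSymbol.sum fun i _ => IsSymbol.deriv hK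
    (IsSymbol.sum fun j _ => IsSymbol.coeff_mul hU hK hKU (hq.deriv hK j) (ha i j)) i

theorem isSymbol_divFormCross (hU : IsOpen U) (ha : ∀ i j, ContDiffOn ℝ ∞ (a i j) U)
    {K : Set (EuclideanSpace ℝ (Fin n))} (hK : IsClosed K) (hKU : K ⊆ U)
    {q : EuclideanSpace ℝ (Fin n) → EuclideanSpace ℝ (Fin n) → ℂ} (hq : IsSymbol K q) :
    IsSymbol K fun ν => divFormCross a ν (q ν) := by
  have hb : ∀ j : Fin n, ContDiff ℝ ∞ fun ν : EuclideanSpace ℝ (Fin n) =>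
      -(2 * Real.pi * Complex.I) * (ν j : ℂ) := fun j =>
    contDiff_const.mul (Complex.ofRealCLM.contDiff.comp
      (EuclideanSpace.proj (𝕜 := ℝ) j).contDiff)
  refine IsSymbol.sum fun i _ => IsSymbol.add (IsSymbol.deriv hK (IsSymbol.sum fun j _ => ?_) i) ?_
  · exact IsSymbol.param_mul (IsSymbol.coeff_mul hU hK hKU hq (ha i j)) (hb j)
  · exact IsSymbol.param_mul (IsSymbol.sum fun j _ =>
      IsSymbol.coeff_mul hU hK hKU (hq.deriv hK j) (ha i j)) (hb i)

end DivergenceForm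

end

noncomputable section

/-! ### Interior regularity with `k`-dependent weights -/

section InteriorRegularity

variable {n : ℕ}

/-- `w` is square integrable on the compact subsets of `U`. -/
def IsLocalL2 (U : Set (EuclideanSpace ℝ (Fin n))) (w : EuclideanSpace ℝ (Fin n) → ℂ) : Prop :=
  ∀ K ⊆ U, IsCompact K → MemLp w 2 (volume.restrict K)

namespace IsLocalL2

variable {U K : Set (EuclideanSpace ℝ (Fin n))} {w c : EuclideanSpace ℝ (Fin n) → ℂ}

theorem memLp_mul (hw : IsLocalL2 U w) (hK : IsCompact K) (hKU : K ⊆ U) (hc : ContinuousOn c K)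
    (h0 : ∀ x ∉ K, c x = 0) : MemLp (fun x => c x * w x) 2 volume := by
  have e : (fun x => c x * w x) = K.indicator fun x => c x * w x := by
    funext x
    by_cases hx : x ∈ K
    · rw [Set.indicator_of_mem hx]
    · rw [Set.indicator_of_notMem hx, h0 x hx, zero_mul]
  rw [e, memLp_indicator_iff_restrict hK.measurableSet]
  obtain ⟨B, hB⟩ := hK.exists_bound_of_continuousOn hc
  have h := hw K hKU hK
  refine h.of_le_mul (c := B) ((hc.aestronglyMeasurable hK.measurableSet).mul h.1) ?_
  filter_upwards [ae_restrict_mem hK.measurableSet] with x hx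
  rw [norm_mul]
  gcongr
  exact hB x hx

theorem integrable_mul (hw : IsLocalL2 U w) (hK : IsCompact K) (hKU : K ⊆ U)
    (hc : ContinuousOn c K) (h0 : ∀ x ∉ K, c x = 0) :
    Integrable (fun x => c x * w x) volume := by
  have h := hw.memLp_mul hK hKU hc h0
  have : Fact (volume K < ⊤) := ⟨hK.measure_lt_top⟩
  have h1 : IntegrableOn (fun x => c x * w x) K volume :=
    (h.restrict K).integrable (by norm_num)
  rwa [integrableOn_iff_integrable_of_support_subset] at h1
  intro x hx
  by_contra hxK
  exact hx (by simp [h0 x hxK])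

end IsLocalL2

theorem fourier_eq_setIntegral_wave {U : Set (EuclideanSpace ℝ (Fin n))}
    {c : EuclideanSpace ℝ (Fin n) → ℂ} (w : EuclideanSpace ℝ (Fin n) → ℂ)
    (h0 : ∀ x ∉ U, c x = 0) (ξ : EuclideanSpace ℝ (Fin n)) :
    𝓕 (fun x => c x * w x) ξ = ∫ x in U, wave ξ x * (c x * w x) := by
  rw [setIntegral_eq_integral_of_forall_compl_eq_zero
    fun x hx => by rw [h0 x hx, zero_mul, mul_zero], Real.fourier_eq']
  rfl

/-- `∑ᵢ ∂ᵢ (∑ⱼ aᵢⱼ ∂ⱼ w) = -ρ w₁` in `U`, in the sense of distributions. -/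
def IsWeakSol (a : Fin n → Fin n → EuclideanSpace ℝ (Fin n) → ℝ)
    (ρ : EuclideanSpace ℝ (Fin n) → ℝ) (U : Set (EuclideanSpace ℝ (Fin n)))
    (w w₁ : EuclideanSpace ℝ (Fin n) → ℂ) : Prop :=
  ∀ ψ : EuclideanSpace ℝ (Fin n) → ℂ, ContDiff ℝ ∞ ψ → HasCompactSupport ψ → tsupport ψ ⊆ U →
    -∫ x in U, divForm a ψ x * w x = ∫ x in U, (ρ x * ψ x) * w₁ x

variable {U : Set (EuclideanSpace ℝ (Fin n))}
  {a : Fin n → Fin n → EuclideanSpace ℝ (Fin n) → ℝ} {ρ : EuclideanSpace ℝ (Fin n) → ℝ}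
  {χ : EuclideanSpace ℝ (Fin n) → ℂ}

/-- Testing a weak solution against `χ(x) / a(x, ν) e^{-2πi t x·ν}`. -/
theorem IsWeakSol.fourier_eq (hU : IsOpen U) (ha : ∀ i j, ContDiffOn ℝ ∞ (a i j) U)
    (hell : ∀ x ∈ U, ∀ v : EuclideanSpace ℝ (Fin n), v ≠ 0 → 0 < ∑ i, ∑ j, a i j x * v i * v j)
    (hχ : ContDiff ℝ ∞ χ) (hχc : HasCompactSupport χ) (hχU : tsupport χ ⊆ U)
    {w w₁ : EuclideanSpace ℝ (Fin n) → ℂ} (hw : IsLocalL2 U w) (h : IsWeakSol a ρ U w w₁)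
    (t : ℝ) {ν : EuclideanSpace ℝ (Fin n)} (hν : ‖ν‖ = 1) :
    4 * Real.pi ^ 2 * t ^ 2 * 𝓕 (fun x => χ x * w x) (t • ν) =
      𝓕 (fun x => divForm a (inverseSymbol a χ ν) x * w x) (t • ν) +
      t * 𝓕 (fun x => divFormCross a ν (inverseSymbol a χ ν) x * w x) (t • ν) +
      𝓕 (fun x => (ρ x * inverseSymbol a χ ν x) * w₁ x) (t • ν) := by
  have hK : IsCompact (tsupport χ) := hχc
  have hq := isSymbol_inverseSymbol hU ha hell hχ hχU
  have h0 := isSymbol_divForm hU ha hK.isClosed hχU hq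
  have h1 := isSymbol_divFormCross hU ha hK.isClosed hχU hq
  have off : ∀ {c : EuclideanSpace ℝ (Fin n) → EuclideanSpace ℝ (Fin n) → ℂ},
      IsSymbol (tsupport χ) c → ∀ x ∉ U, c ν x = 0 := fun hc x hx =>
    hc.eq_zero ν x fun hx' => hx (hχU hx')
  have hχ0 : ∀ x ∉ tsupport χ, χ x = 0 := fun x hx => image_eq_zero_of_notMem_tsupport hx
  rw [fourier_eq_setIntegral_wave w (off h0), fourier_eq_setIntegral_wave w (off h1),
    fourier_eq_setIntegral_wave w (U := U) fun x hx => hχ0 x fun hx' => hx (hχU hx'),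
    fourier_eq_setIntegral_wave w₁ (U := U) fun x hx => by rw [off hq x hx, mul_zero]]
  have hzero : ∀ x ∉ tsupport χ, inverseSymbol a χ ν x * wave (t • ν) x = 0 := fun x hx => by
    rw [hq.eq_zero ν x hx, zero_mul]
  have hts : tsupport (fun x => inverseSymbol a χ ν x * wave (t • ν) x) ⊆ tsupport χ :=
    closure_minimal (fun x hx => by
      by_contra hxK
      exact hx (hzero x hxK)) (isClosed_tsupport χ)
  -- The weak equation is used here. By `principal_mul_inverseSymbol`, the `t²` term of the operator
  -- applied to this test function is `-4π² t² χ` times the wave.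
  have key := h (fun x => inverseSymbol a χ ν x * wave (t • ν) x)
    ((hq.contDiff_apply ν).mul (contDiff_wave _)) (HasCompactSupport.intro hK hzero)
    (hts.trans hχU)
  have int : ∀ {c : EuclideanSpace ℝ (Fin n) → ℂ}, Continuous c → (∀ x ∉ tsupport χ, c x = 0) →
      IntegrableOn (fun x => wave (t • ν) x * (c x * w x)) U volume := fun {c} hc hc0 => by
    have := hw.integrable_mul (c := fun x => wave (t • ν) x * c x) hK hχU
      ((contDiff_wave _).continuous.mul hc).continuousOn
      (fun x hx => by rw [hc0 x hx, mul_zero])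
    exact (this.congr (.of_forall fun x => by simp only; ring)).integrableOn
  have i0 := int (h0.contDiff_apply ν).continuous (h0.eq_zero ν)
  have i1 := int (h1.contDiff_apply ν).continuous (h1.eq_zero ν)
  have i2 := int hχ.continuous hχ0
  have e1 : ∫ x in U, divForm a (fun x => inverseSymbol a χ ν x * wave (t • ν) x) x * w x =
      (∫ x in U, wave (t • ν) x * (divForm a (inverseSymbol a χ ν) x * w x)) +
      t * (∫ x in U, wave (t • ν) x * (divFormCross a ν (inverseSymbol a χ ν) x * w x)) -
      4 * Real.pi ^ 2 * t ^ 2 * ∫ x in U, wave (t • ν) x * (χ x * w x) := by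
    rw [← integral_const_mul, ← integral_const_mul, ← integral_add i0 (i1.const_mul _),
      ← integral_sub (Integrable.fun_add i0 (i1.const_mul _)) (i2.const_mul _)]
    refine setIntegral_congr_fun hU.measurableSet fun x hx => ?_
    beta_reduce
    rw [divForm_mul_wave hU ha (hq.contDiff_apply ν) t ν hx,
      principal_mul_inverseSymbol hell χ hν hx]
    ring
  rw [e1] at key
  have e2 : ∫ x in U, (ρ x * (inverseSymbol a χ ν x * wave (t • ν) x)) * w₁ x =
      ∫ x in U, wave (t • ν) x * ((ρ x * inverseSymbol a χ ν x) * w₁ x) := by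
    refine integral_congr_ae (.of_forall fun x => ?_)
    simp only
    ring
  rw [e2] at key
  linear_combination key

/-- The squared norm `∫ (1 + |ξ|/k)²ʳ |ĝ(ξ)|² dξ`. -/
def scaledSobolevSq (k : ℝ) (r : ℕ) (g : EuclideanSpace ℝ (Fin n) → ℂ) : ℝ≥0∞ :=
  ∫⁻ ξ, (freqWeight k r ξ * ‖𝓕 g ξ‖ₑ) ^ 2

theorem freqWeight_succ (k : ℝ) (hk : 0 < k) (r : ℕ) (ξ : EuclideanSpace ℝ (Fin n)) :
    freqWeight k (r + 1) ξ = freqWeight k r ξ * ENNReal.ofReal (1 + ‖ξ‖ / k) := by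
  unfold freqWeight
  rw [pow_succ, ENNReal.ofReal_mul (by positivity)]

theorem exists_cutoff {K U : Set (EuclideanSpace ℝ (Fin n))} (hK : IsCompact K) (hU : IsOpen U)
    (hKU : K ⊆ U) : ∃ χ : EuclideanSpace ℝ (Fin n) → ℂ, ContDiff ℝ ∞ χ ∧ HasCompactSupport χ ∧
      tsupport χ ⊆ U ∧ ∀ x ∈ K, χ x = 1 := by
  obtain ⟨K', hK', hKK', hK'U⟩ := exists_compact_between hK hU hKU
  obtain ⟨f, hf, -, h0, h1⟩ := exists_contMDiff_zero_iff_one_iff_of_isClosed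
    (modelWithCornersSelf ℝ (EuclideanSpace ℝ (Fin n))) (n := ((⊤ : ℕ∞)))
    (isOpen_interior (s := K')).isClosed_compl hK.isClosed
    (Set.disjoint_compl_left_iff_subset.2 hKK')
  have hz : ∀ x ∉ K', (f x : ℂ) = 0 := fun x hx => by
    rw [(h0 x).1 fun hx' => hx (interior_subset hx'), Complex.ofReal_zero]
  refine ⟨fun x => (f x : ℂ), Complex.ofRealCLM.contDiff.comp hf.contDiff,
    HasCompactSupport.intro hK' hz, ?_, fun x hx => by simp [(h1 x).1 hx]⟩
  refine (closure_minimal (fun x hx => ?_) hK'.isClosed).trans hK'U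
  by_contra hxK
  exact hx (hz x hxK)

theorem ENNReal.add_sq_le_four_mul (a b : ℝ≥0∞) : (a + b) ^ 2 ≤ 4 * (a ^ 2 + b ^ 2) := by
  have h : a + b ≤ 2 * max a b := by
    rw [two_mul]
    exact add_le_add (le_max_left _ _) (le_max_right _ _)
  calc (a + b) ^ 2 ≤ (2 * max a b) ^ 2 := pow_le_pow_left' h 2
    _ = 4 * max a b ^ 2 := by rw [mul_pow]; norm_num
    _ ≤ _ := by
      gcongr
      rcases le_total a b with hab | hab
      · rw [max_eq_right hab]; exact le_add_self
      · rw [max_eq_left hab]; exact le_self_add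

/-- For `t > k` one has `1 + t/k ≤ 2t/k`, and `4π² ≥ 2`; division leaves coefficients `1/(kt)`,
`1/k`, `1/(kt)`. The first two are bounded through `k₀`, while the last keeps `k⁻²`, needed later
against the growth of `w₁`. -/
theorem high_frequency_bound {k₀ k t f x y z : ℝ} (hk₀ : 0 < k₀) (hk : k₀ ≤ k) (ht : k < t)
    (hx : 0 ≤ x) (hy : 0 ≤ y) (hz : 0 ≤ z)
    (h : 4 * Real.pi ^ 2 * t ^ 2 * f ≤ x + t * y + z) :
    (1 + t / k) * f ≤ (k₀⁻¹) ^ 2 * x + k₀⁻¹ * y + (k ^ 2)⁻¹ * z := by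
  have hk' : 0 < k := hk₀.trans_le hk
  have ht' : 0 < t := hk'.trans ht
  have hpi : 3 < Real.pi := Real.pi_gt_three
  have hS : 0 ≤ x + t * y + z := by positivity
  have h1 : f ≤ (x + t * y + z) / (2 * t ^ 2) := by
    rw [le_div_iff₀ (by positivity)]
    rcases le_total 0 f with hf | hf
    · have : 2 * (t ^ 2 * f) ≤ 4 * Real.pi ^ 2 * (t ^ 2 * f) := by
        have h4 : (2 : ℝ) ≤ 4 * Real.pi ^ 2 := by nlinarith
        exact mul_le_mul_of_nonneg_right h4 (by positivity)
      linarith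
    · exact (mul_nonpos_of_nonpos_of_nonneg hf (by positivity)).trans hS
  have h2 : 1 + t / k ≤ 2 * t / k := by
    rw [le_div_iff₀ hk', add_mul, div_mul_cancel₀ _ hk'.ne']
    linarith
  have h3 : 0 ≤ 1 + t / k := by positivity
  calc (1 + t / k) * f ≤ (1 + t / k) * ((x + t * y + z) / (2 * t ^ 2)) := by gcongr
    _ ≤ 2 * t / k * ((x + t * y + z) / (2 * t ^ 2)) := by gcongr
    _ = (k * t)⁻¹ * x + k⁻¹ * y + (k * t)⁻¹ * z := by field_simp
    _ ≤ _ := by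
      have a1 : (k * t)⁻¹ ≤ (k ^ 2)⁻¹ := by
        rw [sq]
        gcongr
      have a2 : (k ^ 2)⁻¹ ≤ (k₀⁻¹) ^ 2 := by
        rw [inv_pow]
        gcongr
      have a3 := a1.trans a2
      gcongr

/-- Interior regularity: localized weak solutions gain one derivative, in the scale of weights
`(1 + |ξ|/k)ʳ`. -/
theorem exists_scaledSobolevSq_succ_le (hn : 1 ≤ n) (hU : IsOpen U)
    (ha : ∀ i j, ContDiffOn ℝ ∞ (a i j) U)
    (hell : ∀ x ∈ U, ∀ v : EuclideanSpace ℝ (Fin n), v ≠ 0 → 0 < ∑ i, ∑ j, a i j x * v i * v j)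
    (hρ : ContDiffOn ℝ ∞ ρ U)
    (hχ : ContDiff ℝ ∞ χ) (hχc : HasCompactSupport χ) (hχU : tsupport χ ⊆ U) (r : ℕ)
    {k₀ : ℝ} (hk₀ : 0 < k₀) {χ' : EuclideanSpace ℝ (Fin n) → ℂ} (hχ' : ContDiff ℝ ∞ χ')
    (hχ'c : HasCompactSupport χ') (hχ'U : tsupport χ' ⊆ U) (hχχ' : ∀ x ∈ tsupport χ, χ' x = 1) :
    ∃ C : ℝ, 0 ≤ C ∧ ∀ k, k₀ ≤ k → ∀ w w₁ : EuclideanSpace ℝ (Fin n) → ℂ,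
      IsLocalL2 U w → IsLocalL2 U w₁ → IsWeakSol a ρ U w w₁ →
      scaledSobolevSq k (r + 1) (fun x => χ x * w x) ≤
        ENNReal.ofReal C * (scaledSobolevSq k r (fun x => χ' x * w x) +
          ENNReal.ofReal ((k ^ 2)⁻¹) ^ 2 * scaledSobolevSq k r (fun x => χ' x * w₁ x)) := by
  have hK : IsCompact (tsupport χ) := hχc
  have hq := isSymbol_inverseSymbol hU ha hell hχ hχU
  have s0 := isSymbol_divForm hU ha hK.isClosed hχU hq
  have s1 := isSymbol_divFormCross hU ha hK.isClosed hχU hq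
  have s2 := IsSymbol.coeff_mul hU hK.isClosed hχU hq hρ
  have s3 : IsSymbol (tsupport χ) fun _ x => χ x :=
    ⟨hχ.comp contDiff_snd, fun _ x hx => image_eq_zero_of_notMem_tsupport hx⟩
  obtain ⟨D0, hD0, b0⟩ := s0.exists_freqWeight_mul_fourier_le hK r hk₀
  obtain ⟨D1, hD1, b1⟩ := s1.exists_freqWeight_mul_fourier_le hK r hk₀
  obtain ⟨D2, hD2, b2⟩ := s2.exists_freqWeight_mul_fourier_le hK r hk₀
  obtain ⟨D3, hD3, b3⟩ := s3.exists_freqWeight_mul_fourier_le hK r hk₀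
  set D := 2 * D3 + (k₀⁻¹) ^ 2 * D0 + k₀⁻¹ * D1 + D2 with hD
  have hD' : 0 ≤ D := by positivity
  set I := ∫⁻ θ : EuclideanSpace ℝ (Fin n), decayKernel θ with hI
  have hItop : I ≠ ⊤ := lintegral_decayKernel_lt_top.ne
  -- The 4 comes from squaring a sum of two terms, `D` from the pointwise symbol bounds, `I` from
  -- Young's inequality.
  refine ⟨4 * (D * I.toReal) ^ 2, by positivity, fun k hk w w₁ hw hw₁ hsol => ?_⟩
  have hk' : 0 < k := hk₀.trans_le hk
  have off' : ∀ x ∉ tsupport χ', χ' x = 0 := fun x hx => image_eq_zero_of_notMem_tsupport hx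
  have hG : Integrable (fun x => χ' x * w x) volume :=
    hw.integrable_mul hχ'c hχ'U hχ'.continuous.continuousOn off'
  have hG₁ : Integrable (fun x => χ' x * w₁ x) volume :=
    hw₁.integrable_mul hχ'c hχ'U hχ'.continuous.continuousOn off'
  have hmeas : ∀ {g : EuclideanSpace ℝ (Fin n) → ℂ}, Integrable g volume →
      Measurable fun η => freqWeight k r η * ‖𝓕 g η‖ₑ := fun {g} hg => by
    have hc : Continuous (𝓕 g) := VectorFourier.fourierIntegral_continuous
      Real.continuous_fourierChar (by exact continuous_inner) hg
    exact (measurable_freqWeight k r).mul hc.measurable.enorm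
  set h₀ : EuclideanSpace ℝ (Fin n) → ℝ≥0∞ :=
    fun η => freqWeight k r η * ‖𝓕 (fun x => χ' x * w x) η‖ₑ with hh₀
  set h₁ : EuclideanSpace ℝ (Fin n) → ℝ≥0∞ :=
    fun η => freqWeight k r η * ‖𝓕 (fun x => χ' x * w₁ x) η‖ₑ with hh₁
  have m₀ : Measurable h₀ := hmeas hG
  have m₁ : Measurable h₁ := hmeas hG₁
  set κ := ENNReal.ofReal ((k ^ 2)⁻¹) with hκ
  set h : EuclideanSpace ℝ (Fin n) → ℝ≥0∞ := fun η => h₀ η + κ * h₁ η with hh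
  have mh : Measurable h := m₀.add (m₁.const_mul κ)
  have hsmear : ∀ ξ, smear h ξ = smear h₀ ξ + κ * smear h₁ ξ := by
    intro ξ
    have m : Measurable fun θ => decayKernel θ * h₀ (ξ + θ) :=
      measurable_decayKernel.mul (m₀.comp (measurable_const_add ξ))
    unfold smear
    rw [← lintegral_const_mul' κ _ ENNReal.ofReal_ne_top, ← lintegral_add_left m]
    refine lintegral_congr fun θ => ?_
    simp only [hh]
    ring
  -- All coefficients live on `tsupport χ`, where `χ' = 1`; so `w` may be replaced by the globally
  -- integrable `χ' w`.
  have insert_cutoff : ∀ {c v : EuclideanSpace ℝ (Fin n) → ℂ}, (∀ x ∉ tsupport χ, c x = 0) →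
      (fun x => c x * v x) = fun x => c x * (χ' x * v x) := fun {c v} hc => by
    funext x
    by_cases hx : x ∈ tsupport χ
    · rw [hχχ' x hx, one_mul]
    · rw [hc x hx, zero_mul, zero_mul]
  have pointwise : ∀ ξ, freqWeight k (r + 1) ξ * ‖𝓕 (fun x => χ x * w x) ξ‖ₑ ≤
      ENNReal.ofReal D * smear h ξ := by
    intro ξ
    rw [freqWeight_succ k hk']
    -- At low frequency the extra weight is at most 2, so multiplication by `χ` alone suffices; the
    -- equation is needed only for `‖ξ‖ > k`.
    rcases le_or_gt ‖ξ‖ k with hξ | hξ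
    · have hν : ‖(EuclideanSpace.single ⟨0, hn⟩ 1 : EuclideanSpace ℝ (Fin n))‖ = 1 := by simp
      have b := b3 k hk _ hν _ hG ξ
      rw [← insert_cutoff fun x hx => image_eq_zero_of_notMem_tsupport hx] at b
      have h2 : ENNReal.ofReal (1 + ‖ξ‖ / k) ≤ ENNReal.ofReal 2 := by
        refine ENNReal.ofReal_le_ofReal ?_
        have : ‖ξ‖ / k ≤ 1 := (div_le_one hk').2 hξ
        linarith
      calc freqWeight k r ξ * ENNReal.ofReal (1 + ‖ξ‖ / k) * ‖𝓕 (fun x => χ x * w x) ξ‖ₑ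
          = ENNReal.ofReal (1 + ‖ξ‖ / k) *
            (freqWeight k r ξ * ‖𝓕 (fun x => χ x * w x) ξ‖ₑ) := by ring
        _ ≤ ENNReal.ofReal 2 * (ENNReal.ofReal D3 * smear h₀ ξ) := by gcongr
        _ = ENNReal.ofReal (2 * D3) * smear h₀ ξ := by
          rw [ENNReal.ofReal_mul two_pos.le, mul_assoc]
        _ ≤ ENNReal.ofReal D * smear h ξ := by
          rw [hsmear]
          gcongr
          · have : 0 ≤ (k₀⁻¹) ^ 2 * D0 + k₀⁻¹ * D1 + D2 := by positivity
            linarith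
          · exact le_self_add
    · have ht : 0 < ‖ξ‖ := hk'.trans hξ
      set ν := ‖ξ‖⁻¹ • ξ with hν_def
      have hν : ‖ν‖ = 1 := by
        rw [hν_def, norm_smul, norm_inv, norm_norm, inv_mul_cancel₀ ht.ne']
      have hξν : ‖ξ‖ • ν = ξ := by
        rw [hν_def, smul_smul, mul_inv_cancel₀ ht.ne', one_smul]
      have id := hsol.fourier_eq hU ha hell hχ hχc hχU hw ‖ξ‖ hν
      rw [hξν] at id
      have c0 := b0 k hk ν hν _ hG ξ
      have c1 := b1 k hk ν hν _ hG ξ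
      have c2 := b2 k hk ν hν _ hG₁ ξ
      rw [← insert_cutoff (s0.eq_zero ν)] at c0
      rw [← insert_cutoff (s1.eq_zero ν)] at c1
      rw [← insert_cutoff (s2.eq_zero ν)] at c2
      set F := 𝓕 (fun x => χ x * w x) ξ
      set T0 := 𝓕 (fun x => divForm a (inverseSymbol a χ ν) x * w x) ξ
      set T1 := 𝓕 (fun x => divFormCross a ν (inverseSymbol a χ ν) x * w x) ξ
      set T2 := 𝓕 (fun x => (ρ x * inverseSymbol a χ ν x) * w₁ x) ξ
      have hnorm : 4 * Real.pi ^ 2 * ‖ξ‖ ^ 2 * ‖F‖ ≤ ‖T0‖ + ‖ξ‖ * ‖T1‖ + ‖T2‖ := by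
        have e : ‖(4 * Real.pi ^ 2 * ‖ξ‖ ^ 2 : ℂ) * F‖ = 4 * Real.pi ^ 2 * ‖ξ‖ ^ 2 * ‖F‖ := by
          rw [norm_mul]
          congr 1
          simp
        rw [← e, id]
        refine (norm_add_le _ _).trans ?_
        gcongr
        refine (norm_add_le _ _).trans ?_
        rw [norm_mul]
        simp
      have hb := high_frequency_bound hk₀ hk hξ (norm_nonneg T0) (norm_nonneg T1)
        (norm_nonneg T2) hnorm
      have hb' : ENNReal.ofReal (1 + ‖ξ‖ / k) * ‖F‖ₑ ≤
          ENNReal.ofReal ((k₀⁻¹) ^ 2) * ‖T0‖ₑ + ENNReal.ofReal k₀⁻¹ * ‖T1‖ₑ + κ * ‖T2‖ₑ := by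
        simp only [hκ, ← ofReal_norm]
        rw [← ENNReal.ofReal_mul (by positivity), ← ENNReal.ofReal_mul (by positivity),
          ← ENNReal.ofReal_mul (by positivity), ← ENNReal.ofReal_mul (by positivity),
          ← ENNReal.ofReal_add (by positivity) (by positivity),
          ← ENNReal.ofReal_add (by positivity) (by positivity)]
        exact ENNReal.ofReal_le_ofReal hb
      calc freqWeight k r ξ * ENNReal.ofReal (1 + ‖ξ‖ / k) * ‖F‖ₑ
          ≤ freqWeight k r ξ * (ENNReal.ofReal ((k₀⁻¹) ^ 2) * ‖T0‖ₑ +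
              ENNReal.ofReal k₀⁻¹ * ‖T1‖ₑ + κ * ‖T2‖ₑ) := by
            rw [mul_assoc]; gcongr
        _ = ENNReal.ofReal ((k₀⁻¹) ^ 2) * (freqWeight k r ξ * ‖T0‖ₑ) +
              ENNReal.ofReal k₀⁻¹ * (freqWeight k r ξ * ‖T1‖ₑ) +
              κ * (freqWeight k r ξ * ‖T2‖ₑ) := by ring
        _ ≤ ENNReal.ofReal ((k₀⁻¹) ^ 2) * (ENNReal.ofReal D0 * smear h₀ ξ) +
              ENNReal.ofReal k₀⁻¹ * (ENNReal.ofReal D1 * smear h₀ ξ) +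
              κ * (ENNReal.ofReal D2 * smear h₁ ξ) := by gcongr
        _ = ENNReal.ofReal ((k₀⁻¹) ^ 2 * D0 + k₀⁻¹ * D1) * smear h₀ ξ +
              ENNReal.ofReal D2 * (κ * smear h₁ ξ) := by
            rw [ENNReal.ofReal_add (by positivity) (by positivity),
              ENNReal.ofReal_mul (by positivity), ENNReal.ofReal_mul (by positivity)]
            ring
        _ ≤ ENNReal.ofReal D * smear h₀ ξ + ENNReal.ofReal D * (κ * smear h₁ ξ) := by
            have p1 : (k₀⁻¹) ^ 2 * D0 + k₀⁻¹ * D1 ≤ D := by rw [hD]; linarith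
            have p2 : D2 ≤ D := by
              have : 0 ≤ (k₀⁻¹) ^ 2 * D0 + k₀⁻¹ * D1 := by positivity
              rw [hD]; linarith
            gcongr
        _ = ENNReal.ofReal D * smear h ξ := by rw [hsmear, mul_add]
  calc scaledSobolevSq k (r + 1) (fun x => χ x * w x)
      ≤ ∫⁻ ξ, (ENNReal.ofReal D * smear h ξ) ^ 2 :=
        lintegral_mono fun ξ => pow_le_pow_left' (pointwise ξ) 2
    _ = ENNReal.ofReal D ^ 2 * ∫⁻ ξ, smear h ξ ^ 2 := by
        simp only [mul_pow]
        rw [lintegral_const_mul _ ((measurable_smear mh).pow_const 2)]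
    _ ≤ ENNReal.ofReal D ^ 2 * (I ^ 2 * ∫⁻ ξ, h ξ ^ 2) := by
        gcongr
        exact lintegral_smear_sq_le mh
    _ ≤ ENNReal.ofReal D ^ 2 * (I ^ 2 * (4 * ((∫⁻ ξ, h₀ ξ ^ 2) + κ ^ 2 * ∫⁻ ξ, h₁ ξ ^ 2))) := by
        have m : Measurable fun ξ => h₀ ξ ^ 2 + κ ^ 2 * h₁ ξ ^ 2 :=
          (m₀.pow_const 2).add ((m₁.pow_const 2).const_mul _)
        gcongr
        rw [← lintegral_const_mul _ (m₁.pow_const 2), ← lintegral_add_left (m₀.pow_const 2),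
          ← lintegral_const_mul _ m]
        refine lintegral_mono fun ξ => ?_
        rw [← mul_pow]
        exact ENNReal.add_sq_le_four_mul _ _
    _ = _ := by
        have e : ENNReal.ofReal (4 * (D * I.toReal) ^ 2) = 4 * (ENNReal.ofReal D ^ 2 * I ^ 2) := by
          rw [ENNReal.ofReal_mul (by norm_num), ENNReal.ofReal_pow (by positivity),
            ENNReal.ofReal_mul hD', ENNReal.ofReal_toReal hItop, mul_pow]
          norm_num
        rw [e]
        unfold scaledSobolevSq
        ring

end InteriorRegularity

end

noncomputable section

/-! ### Pulling `L²(Γ)` back to local coordinates -/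

namespace SurfaceChart

variable {n : ℕ} {Γ : Set (EuclideanSpace ℝ (Fin (n + 1)))} (κ : SurfaceChart Γ)

/-- An injective linear map in finite dimension is antilipschitz, and near `x` the chart differs
from its derivative by a map of small Lipschitz constant. Taking half of `L⁻¹` for that constant
keeps the sum antilipschitz. -/
theorem exists_antilipschitz {x : EuclideanSpace ℝ (Fin n)} (hx : x ∈ κ.source) :
    ∃ V ∈ nhds x, ∃ L : NNReal, AntilipschitzWith L (V.domRestrict κ.param) := by
  have hs : HasStrictFDerivAt κ.param (fderiv ℝ κ.param x) x :=
    (κ.contDiffOn_param.contDiffAt (κ.isOpen_source.mem_nhds hx)).hasStrictFDerivAt (by simp)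
  obtain ⟨L, hL, hanti⟩ := LinearMap.exists_antilipschitzWith
    (fderiv ℝ κ.param x).toLinearMap (LinearMap.ker_eq_bot.2 (κ.injective_fderiv x hx))
  have hc : 0 < L⁻¹ / 2 := by positivity
  obtain ⟨V, hV, happ⟩ := hs.approximates_deriv_on_nhds (c := L⁻¹ / 2) (Or.inr hc)
  refine ⟨V, hV, (L⁻¹ - L⁻¹ / 2)⁻¹, ?_⟩
  have h := (AntilipschitzWith.domRestrict hanti V).add_lipschitzWith happ.lipschitz_sub
    (NNReal.half_lt_self (by positivity))
  convert! h using 1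
  funext y
  simp [Set.domRestrict]

/-- On compact subsets of the chart, Lebesgue measure is bounded by the surface measure. -/
theorem exists_map_le {K : Set (EuclideanSpace ℝ (Fin n))} (hK : IsCompact K)
    (hKs : K ⊆ κ.source) :
    ∃ C : ℝ≥0∞, C ≠ ⊤ ∧
      (volume.restrict K).map κ.param ≤ C • surfaceMeasure Γ := by
  have hset : ∃ C : ℝ≥0∞, C ≠ ⊤ ∧ ∀ B : Set (EuclideanSpace ℝ (Fin (n + 1))),
      volume (K ∩ κ.source ∩ κ.param ⁻¹' B) ≤
        C * (μHE[n] : Measure (EuclideanSpace ℝ (Fin (n + 1)))) (B ∩ Γ) := by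
    -- The bound is local and stable under finite unions, so compactness reduces it to a
    -- neighbourhood where the chart is antilipschitz.
    refine hK.induction_on (p := fun S => ∃ C : ℝ≥0∞, C ≠ ⊤ ∧
      ∀ B : Set (EuclideanSpace ℝ (Fin (n + 1))), volume (S ∩ κ.source ∩ κ.param ⁻¹' B) ≤
        C * (μHE[n] : Measure (EuclideanSpace ℝ (Fin (n + 1)))) (B ∩ Γ)) ?_ ?_ ?_ ?_
    · exact ⟨0, by simp, by simp⟩
    · rintro S T hST ⟨C, hC, h⟩
      refine ⟨C, hC, fun B => (measure_mono ?_).trans (h B)⟩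
      gcongr
    · rintro S T ⟨C, hC, h⟩ ⟨C', hC', h'⟩
      refine ⟨C + C', by simp [hC, hC'], fun B => ?_⟩
      rw [add_mul, Set.union_inter_distrib_right, Set.union_inter_distrib_right]
      exact (measure_union_le _ _).trans (add_le_add (h B) (h' B))
    · intro x hx
      obtain ⟨V, hV, L, hL⟩ := κ.exists_antilipschitz (hKs hx)
      refine ⟨V, nhdsWithin_le_nhds hV, (L : ℝ≥0∞) ^ (n : ℝ), by simp, fun B => ?_⟩
      -- Lebesgue measure and the surface measure are the same multiple of Hausdorff measure, so the
      -- normalization drops out and the antilipschitz bound gives the factor `L ^ n`.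
      rw [← EuclideanSpace.euclideanHausdorffMeasure_eq_volume,
        Measure.euclideanHausdorffMeasure_def, Measure.euclideanHausdorffMeasure_def]
      simp only [Measure.smul_apply]
      rw [mul_smul_comm]
      gcongr
      set S : Set V := {y | (y : EuclideanSpace ℝ (Fin n)) ∈ κ.source ∧ κ.param y ∈ B}
      have e : V ∩ κ.source ∩ κ.param ⁻¹' B = Subtype.val '' S := by
        ext y
        simp only [Set.mem_inter_iff, Set.mem_preimage, Set.mem_image, Set.mem_ofPred_eq, S,
          Subtype.exists, exists_and_right, exists_eq_right]
        tauto
      rw [e, isometry_subtype_coe.hausdorffMeasure_image (Or.inl n.cast_nonneg)]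
      refine (hL.le_hausdorffMeasure_image n.cast_nonneg S).trans ?_
      gcongr
      rintro _ ⟨y, hy, rfl⟩
      exact ⟨hy.2, κ.mapsTo_param hy.1⟩
  obtain ⟨C, hC, h⟩ := hset
  refine ⟨C, hC, Measure.le_iff.2 fun B hB => ?_⟩
  have hm : AEMeasurable κ.param (volume.restrict K) :=
    (κ.contDiffOn_param.continuousOn.mono hKs).aemeasurable hK.measurableSet
  rw [Measure.map_apply_of_aemeasurable hm hB, Measure.restrict_apply' hK.measurableSet,
    Measure.smul_apply, surfaceMeasure, Measure.restrict_apply hB, smul_eq_mul]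
  refine (measure_mono ?_).trans (h B)
  rintro y ⟨hyB, hyK⟩
  exact ⟨⟨hyK, hKs hyK⟩, hyB⟩

theorem aemeasurable_param {K : Set (EuclideanSpace ℝ (Fin n))} (hK : IsCompact K)
    (hKs : K ⊆ κ.source) : AEMeasurable κ.param (volume.restrict K) :=
  (κ.contDiffOn_param.continuousOn.mono hKs).aemeasurable hK.measurableSet

theorem ae_comp_param {K : Set (EuclideanSpace ℝ (Fin n))} (hK : IsCompact K)
    (hKs : K ⊆ κ.source) {p : EuclideanSpace ℝ (Fin (n + 1)) → Prop}
    (hp : ∀ᵐ y ∂surfaceMeasure Γ, p y) : ∀ᵐ x ∂volume.restrict K, p (κ.param x) := by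
  obtain ⟨C, -, h⟩ := κ.exists_map_le hK hKs
  exact ae_of_ae_map (κ.aemeasurable_param hK hKs)
    ((Measure.absolutelyContinuous_of_le_smul h).ae_le hp)

theorem exists_eLpNorm_comp_param_le {K : Set (EuclideanSpace ℝ (Fin n))} (hK : IsCompact K)
    (hKs : K ⊆ κ.source) :
    ∃ C : ℝ, 0 ≤ C ∧ ∀ w : SurfaceL2 Γ,
      AEStronglyMeasurable (fun x => w (κ.param x)) (volume.restrict K) ∧
      eLpNorm (fun x => w (κ.param x)) 2 (volume.restrict K) ≤ ENNReal.ofReal (C * ‖w‖) := by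
  obtain ⟨C, hC, h⟩ := κ.exists_map_le hK hKs
  have hm := κ.aemeasurable_param hK hKs
  have hC' : C ^ (1 / (2 : ℝ≥0∞)).toReal ≠ ⊤ := ENNReal.rpow_ne_top_of_nonneg (by simp) hC
  refine ⟨(C ^ (1 / (2 : ℝ≥0∞)).toReal).toReal, ENNReal.toReal_nonneg, fun w => ?_⟩
  have hw : AEStronglyMeasurable w ((volume.restrict K).map κ.param) :=
    (Lp.aestronglyMeasurable w).mono_ac (Measure.absolutelyContinuous_of_le_smul h)
  refine ⟨hw.comp_aemeasurable hm, ?_⟩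
  calc eLpNorm (fun x => w (κ.param x)) 2 (volume.restrict K)
      = eLpNorm w 2 ((volume.restrict K).map κ.param) := (eLpNorm_map_measure hw hm).symm
    _ ≤ eLpNorm w 2 (C • surfaceMeasure Γ) := eLpNorm_mono_measure _ h
    _ = C ^ (1 / (2 : ℝ≥0∞)).toReal • eLpNorm w 2 (surfaceMeasure Γ) :=
        eLpNorm_smul_measure_of_ne_top (by norm_num) _ _
    _ = _ := by
        rw [ENNReal.ofReal_mul ENNReal.toReal_nonneg, ENNReal.ofReal_toReal hC', ← Lp.enorm_def,
          ofReal_norm, smul_eq_mul]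

theorem isLocalL2_comp_param (w : SurfaceL2 Γ) :
    IsLocalL2 κ.source fun x => w (κ.param x) := fun K hKs hK => by
  obtain ⟨C, -, h⟩ := κ.exists_eLpNorm_comp_param_le hK hKs
  exact ⟨(h w).1, (h w).2.trans_lt ENNReal.ofReal_lt_top⟩

/-- Restriction of functions on `Γ` to a compact set of local coordinates. -/
def pullback {K : Set (EuclideanSpace ℝ (Fin n))} (hK : IsCompact K) (hKs : K ⊆ κ.source) :
    SurfaceL2 Γ →L[ℂ] Lp ℂ 2 (volume.restrict K) :=
  LinearMap.mkContinuousOfExistsBound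
    { toFun := fun w => (κ.isLocalL2_comp_param w K hKs hK).toLp _
      map_add' := fun v w => by
        rw [← MemLp.toLp_add]
        refine MemLp.toLp_congr _ _ ?_
        exact κ.ae_comp_param hK hKs (Lp.coeFn_add v w)
      map_smul' := fun c w => by
        rw [RingHom.id_apply, ← MemLp.toLp_const_smul]
        refine MemLp.toLp_congr _ _ ?_
        exact κ.ae_comp_param hK hKs (Lp.coeFn_smul c w) }
    (by
      obtain ⟨C, hC, h⟩ := κ.exists_eLpNorm_comp_param_le hK hKs
      refine ⟨C, fun w => ?_⟩
      simp only [LinearMap.coe_mk, AddHom.coe_mk, Lp.norm_toLp]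
      exact ENNReal.toReal_le_of_le_ofReal (by positivity) (h w).2)

/-- Continuity on `L²(Γ)` is what lets eigenfunction series pass through local integrals. The
functional is the inner product with the conjugate of `φ` after pullback to `K`. -/
theorem exists_integralFunctional {K : Set (EuclideanSpace ℝ (Fin n))} (hK : IsCompact K)
    (hKs : K ⊆ κ.source) {φ : EuclideanSpace ℝ (Fin n) → ℂ} (hφ : ContinuousOn φ K)
    (h0 : ∀ x ∉ K, φ x = 0) :
    ∃ Φ : SurfaceL2 Γ →L[ℂ] ℂ, ∀ w, Φ w = ∫ x in κ.source, φ x * w (κ.param x) := by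
  have : IsFiniteMeasure (volume.restrict K) := isFiniteMeasure_restrict.2 hK.measure_lt_top.ne
  obtain ⟨B, hB⟩ := hK.exists_bound_of_continuousOn hφ
  have hφm : MemLp (fun x => (starRingEnd ℂ) (φ x)) 2 (volume.restrict K) := by
    refine MemLp.of_bound
      ((Complex.continuous_conj.comp_continuousOn hφ).aestronglyMeasurable hK.measurableSet) B ?_
    filter_upwards [ae_restrict_mem hK.measurableSet] with x hx
    simpa using hB x hx
  refine ⟨(innerSL ℂ (hφm.toLp _)).comp (κ.pullback hK hKs), fun w => ?_⟩
  rw [ContinuousLinearMap.comp_apply, innerSL_apply_apply, L2.inner_def]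
  have e : ∫ x in κ.source, φ x * w (κ.param x) = ∫ x in K, φ x * w (κ.param x) :=
    setIntegral_eq_of_subset_of_forall_sdiff_eq_zero κ.isOpen_source.measurableSet hKs
      fun x hx => by rw [h0 x hx.2, zero_mul]
  rw [e]
  refine integral_congr_ae ?_
  filter_upwards [hφm.coeFn_toLp, (κ.isLocalL2_comp_param w K hKs hK).coeFn_toLp] with x h1 h2
  have h3 : (κ.pullback hK hKs w) x = w (κ.param x) := h2
  rw [h1, h3]
  simp [mul_comm]

end SurfaceChart

end

noncomputable section

/-! ### The operator on complex test functions -/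

section Complexification

variable {n : ℕ} {U : Set (EuclideanSpace ℝ (Fin n))}
  {a : Fin n → Fin n → EuclideanSpace ℝ (Fin n) → ℝ}

theorem divForm_add_mul (hU : IsOpen U) (ha : ∀ i j, ContDiffOn ℝ ∞ (a i j) U)
    {φ φ' : EuclideanSpace ℝ (Fin n) → ℂ} (hφ : ContDiff ℝ ∞ φ) (hφ' : ContDiff ℝ ∞ φ') (c : ℂ)
    {x : EuclideanSpace ℝ (Fin n)} (hx : x ∈ U) :
    divForm a (fun y => φ y + c * φ' y) x = divForm a φ x + c * divForm a φ' x := by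
  have had := differentiableAt_coeff hU ha hx
  have hd : ∀ {θ : EuclideanSpace ℝ (Fin n) → ℂ}, ContDiff ℝ ∞ θ → ∀ y,
      DifferentiableAt ℝ θ y := fun h y => h.contDiffAt.differentiableAt (by simp)
  have hdd : ∀ {θ : EuclideanSpace ℝ (Fin n) → ℂ}, ContDiff ℝ ∞ θ → ∀ i, DifferentiableAt ℝ
      (fun y => ∑ j, (a i j y : ℂ) * partialDeriv j θ y) x := fun h i =>
    DifferentiableAt.fun_sum fun j _ => (had i j).mul (hd (h.partialDeriv j) x)
  unfold divForm
  rw [Finset.mul_sum, ← Finset.sum_add_distrib]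
  refine Finset.sum_congr rfl fun i _ => ?_
  rw [← partialDeriv_const_mul (hdd hφ' i), ← partialDeriv_add (hdd hφ i)
    ((hdd hφ' i).const_mul c)]
  congr 1
  funext y
  rw [Finset.mul_sum, ← Finset.sum_add_distrib]
  refine Finset.sum_congr rfl fun j _ => ?_
  rw [partialDeriv_add (hd hφ y) ((hd hφ' y).const_mul c), partialDeriv_const_mul (hd hφ' y)]
  ring

theorem continuousOn_divForm (hU : IsOpen U) (ha : ∀ i j, ContDiffOn ℝ ∞ (a i j) U)
    {φ : EuclideanSpace ℝ (Fin n) → ℂ} (hφ : ContDiff ℝ ∞ φ) :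
    ContinuousOn (divForm a φ) U := by
  refine continuousOn_finsetSum _ fun i _ => (ContDiffOn.partialDeriv hU ?_ i).continuousOn
  exact ContDiffOn.sum fun j _ => (Complex.ofRealCLM.contDiff.comp_contDiffOn (ha i j)).mul
    (hφ.partialDeriv j).contDiffOn

theorem divForm_eq_zero_of_notMem {K : Set (EuclideanSpace ℝ (Fin n))} (hK : IsClosed K)
    {φ : EuclideanSpace ℝ (Fin n) → ℂ} (h0 : ∀ x ∉ K, φ x = 0) {x : EuclideanSpace ℝ (Fin n)}
    (hx : x ∉ K) : divForm a φ x = 0 :=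
  Finset.sum_eq_zero fun i _ => partialDeriv_eq_zero_of_notMem hK
    (fun y hy => Finset.sum_eq_zero fun j _ => by
      rw [partialDeriv_eq_zero_of_notMem hK h0 j hy, mul_zero]) i hx

end Complexification

/-! ### From eigenfunctions to weak solutions in charts -/

section WeakEquation

variable {n : ℕ} {Γ : Set (EuclideanSpace ℝ (Fin (n + 1)))}

theorem SurfaceChart.laplaceBeltrami_mul_density (κ : SurfaceChart Γ)
    {ψ : EuclideanSpace ℝ (Fin n) → ℝ} (hψ : ContDiff ℝ ∞ ψ) {x : EuclideanSpace ℝ (Fin n)}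
    (hx : x ∈ κ.source) :
    ((κ.laplaceBeltrami ψ x * κ.density x : ℝ) : ℂ) =
      divForm κ.metricCoeff (fun y => (ψ y : ℂ)) x := by
  have e : ∀ i, (fun y => ∑ j, (κ.metricCoeff i j y : ℂ) *
      partialDeriv j (fun y => (ψ y : ℂ)) y) = fun y =>
      ((κ.density y * ∑ j, (κ.gram y)⁻¹ i j * partialDeriv j ψ y : ℝ) : ℂ) := by
    intro i
    funext y
    rw [Finset.mul_sum, Complex.ofReal_sum]
    refine Finset.sum_congr rfl fun j _ => ?_
    rw [partialDeriv_ofReal (hψ.contDiffAt.differentiableAt (by simp)),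
      SurfaceChart.metricCoeff]
    push_cast
    ring
  have hd : ∀ i, DifferentiableAt ℝ
      (fun y => κ.density y * ∑ j, (κ.gram y)⁻¹ i j * partialDeriv j ψ y) x := by
    intro i
    have h : ContDiffOn ℝ ∞ (fun y => ∑ j, κ.metricCoeff i j y * partialDeriv j ψ y) κ.source :=
      ContDiffOn.sum fun j _ => (κ.contDiffOn_metricCoeff i j).mul (hψ.partialDeriv j).contDiffOn
    have h' := (h.contDiffAt (κ.isOpen_source.mem_nhds hx)).differentiableAt (by simp)
    refine h'.congr_of_eventuallyEq (.of_forall fun y => ?_)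
    simp only [SurfaceChart.metricCoeff, Finset.mul_sum, mul_assoc]
  unfold divForm SurfaceChart.laplaceBeltrami
  simp only [e]
  rw [mul_comm, ← mul_assoc, mul_inv_cancel₀ (κ.density_pos hx).ne', one_mul, Complex.ofReal_sum]
  exact Finset.sum_congr rfl fun i _ => (partialDeriv_ofReal (hd i) i).symm

/-- `-Δ_Γ w = w₁` in the sense of distributions, in every chart. -/
def IsSurfaceWeakSol (w w₁ : SurfaceL2 Γ) : Prop :=
  ∀ κ : SurfaceChart Γ, IsWeakSol κ.metricCoeff κ.density κ.source
    (fun x => w (κ.param x)) (fun x => w₁ (κ.param x))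

/-- `IsLaplaceEigen` tests only against real functions, whereas the plane-wave test functions are
complex; linearity over real and imaginary parts bridges the gap. -/
theorem IsLaplaceEigen.integral_divForm {u : SurfaceL2 Γ} {l : ℝ} (h : IsLaplaceEigen Γ u l)
    (κ : SurfaceChart Γ) {ψ : EuclideanSpace ℝ (Fin n) → ℂ} (hψ : ContDiff ℝ ∞ ψ)
    (hψc : HasCompactSupport ψ) (hψU : tsupport ψ ⊆ κ.source) :
    -∫ x in κ.source, divForm κ.metricCoeff ψ x * u (κ.param x) =
      l * ∫ x in κ.source, (κ.density x * ψ x) * u (κ.param x) := by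
  have hK : IsCompact (tsupport ψ) := hψc
  have hU := κ.isOpen_source
  have real : ∀ φ : EuclideanSpace ℝ (Fin n) → ℝ, ContDiff ℝ ∞ φ → (∀ x ∉ tsupport ψ, φ x = 0) →
      IntegrableOn (fun x => divForm κ.metricCoeff (fun y => (φ y : ℂ)) x * u (κ.param x))
        κ.source ∧
      IntegrableOn (fun x => (κ.density x * (φ x : ℂ)) * u (κ.param x)) κ.source ∧
      -∫ x in κ.source, divForm κ.metricCoeff (fun y => (φ y : ℂ)) x * u (κ.param x) =
        l * ∫ x in κ.source, (κ.density x * (φ x : ℂ)) * u (κ.param x) := by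
    intro φ hφ h0
    have hφC : ContDiff ℝ ∞ fun y => (φ y : ℂ) := Complex.ofRealCLM.contDiff.comp hφ
    have h0C : ∀ x ∉ tsupport ψ, (φ x : ℂ) = 0 := fun x hx => by rw [h0 x hx, Complex.ofReal_zero]
    have hu := κ.isLocalL2_comp_param u
    refine ⟨?_, ?_, ?_⟩
    · exact (hu.integrable_mul hK hψU ((continuousOn_divForm hU κ.contDiffOn_metricCoeff hφC).mono
        hψU) fun x hx => divForm_eq_zero_of_notMem hK.isClosed h0C hx).integrableOn
    · refine (hu.integrable_mul (c := fun x => κ.density x * (φ x : ℂ)) hK hψU ?_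
        fun x hx => by rw [h0C x hx, mul_zero]).integrableOn
      exact (Complex.continuous_ofReal.comp_continuousOn
        (κ.contDiffOn_density.continuousOn.mono hψU)).mul hφC.continuous.continuousOn
    · have hts : tsupport φ ⊆ tsupport ψ := closure_minimal (fun x hx => by
        by_contra hxK
        exact hx (h0 x hxK)) (isClosed_tsupport ψ)
      have e := h κ φ hφ (HasCompactSupport.intro hK h0) (hts.trans hψU)
      rw [← integral_neg]
      calc _ = ∫ x in κ.source, (-(κ.laplaceBeltrami φ x) * κ.density x) • u (κ.param x) := by
            refine setIntegral_congr_fun hU.measurableSet fun x hx => ?_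
            beta_reduce
            rw [← κ.laplaceBeltrami_mul_density hφ hx, Complex.real_smul]
            push_cast
            ring
        _ = _ := e
        _ = _ := by
            congr 1
            refine integral_congr_ae (.of_forall fun x => ?_)
            beta_reduce
            rw [Complex.real_smul]
            push_cast
            ring
  have hre : ContDiff ℝ ∞ fun x => (ψ x).re := Complex.reCLM.contDiff.comp hψ
  have him : ContDiff ℝ ∞ fun x => (ψ x).im := Complex.imCLM.contDiff.comp hψ
  have hreC : ContDiff ℝ ∞ fun x => ((ψ x).re : ℂ) := Complex.ofRealCLM.contDiff.comp hre
  have himC : ContDiff ℝ ∞ fun x => ((ψ x).im : ℂ) := Complex.ofRealCLM.contDiff.comp him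
  have hψ0 : ∀ x ∉ tsupport ψ, ψ x = 0 := fun x hx => image_eq_zero_of_notMem_tsupport hx
  obtain ⟨i1, j1, e1⟩ := real _ hre fun x hx => by rw [hψ0 x hx, Complex.zero_re]
  obtain ⟨i2, j2, e2⟩ := real _ him fun x hx => by rw [hψ0 x hx, Complex.zero_im]
  have hsplit : ψ = fun x => ((ψ x).re : ℂ) + Complex.I * ((ψ x).im : ℂ) := by
    funext x
    rw [mul_comm, Complex.re_add_im]
  have s1 : ∫ x in κ.source, divForm κ.metricCoeff ψ x * u (κ.param x) =
      (∫ x in κ.source, divForm κ.metricCoeff (fun y => ((ψ y).re : ℂ)) x * u (κ.param x)) +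
      Complex.I *
        ∫ x in κ.source, divForm κ.metricCoeff (fun y => ((ψ y).im : ℂ)) x * u (κ.param x) := by
    rw [← integral_const_mul, ← integral_add i1 (i2.const_mul _)]
    refine setIntegral_congr_fun hU.measurableSet fun x hx => ?_
    beta_reduce
    conv_lhs => rw [hsplit]
    rw [divForm_add_mul hU κ.contDiffOn_metricCoeff hreC himC Complex.I hx]
    ring
  have s2 : ∫ x in κ.source, (κ.density x * ψ x) * u (κ.param x) =
      (∫ x in κ.source, (κ.density x * ((ψ x).re : ℂ)) * u (κ.param x)) +
      Complex.I * ∫ x in κ.source, (κ.density x * ((ψ x).im : ℂ)) * u (κ.param x) := by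
    rw [← integral_const_mul, ← integral_add j1 (j2.const_mul _)]
    refine setIntegral_congr_fun hU.measurableSet fun x hx => ?_
    beta_reduce
    conv_lhs => rw [hsplit]
    ring
  rw [s1, s2, mul_add, ← e1, mul_left_comm, ← e2]
  ring

/-- For a fixed test function both sides are continuous linear functionals, so the identity for each
eigenfunction sums over the series. -/
theorem isSurfaceWeakSol_of_hasSum {ι : Type*} {u : ι → SurfaceL2 Γ} {lam : ι → ℝ}
    (hu : ∀ j, IsLaplaceEigen Γ (u j) (lam j)) {c : ι → ℂ} {w w₁ : SurfaceL2 Γ}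
    (hw : HasSum (fun j => c j • u j) w) (hw₁ : HasSum (fun j => (lam j * c j) • u j) w₁) :
    IsSurfaceWeakSol w w₁ := by
  intro κ ψ hψ hψc hψU
  have hK : IsCompact (tsupport ψ) := hψc
  have hψ0 : ∀ x ∉ tsupport ψ, ψ x = 0 := fun x hx => image_eq_zero_of_notMem_tsupport hx
  obtain ⟨Φ, hΦ⟩ := κ.exists_integralFunctional hK hψU (φ := divForm κ.metricCoeff ψ)
    ((continuousOn_divForm κ.isOpen_source κ.contDiffOn_metricCoeff hψ).mono hψU)
    fun x hx => divForm_eq_zero_of_notMem hK.isClosed hψ0 hx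
  obtain ⟨Ψ, hΨ⟩ := κ.exists_integralFunctional hK hψU (φ := fun x => κ.density x * ψ x)
    ((Complex.continuous_ofReal.comp_continuousOn
        (κ.contDiffOn_density.continuousOn.mono hψU)).mul hψ.continuous.continuousOn)
    fun x hx => by rw [hψ0 x hx, mul_zero]
  rw [← hΦ, ← hΨ]
  have h1 := (hw.mapL Φ).neg
  have h2 := hw₁.mapL Ψ
  have e : (fun j => -Φ (c j • u j)) = fun j => Ψ ((lam j * c j) • u j) := by
    funext j
    have e := (hu j).integral_divForm κ hψ hψc hψU
    rw [← hΦ, ← hΨ] at e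
    rw [map_smul, map_smul, smul_eq_mul, smul_eq_mul]
    linear_combination (c j) * e
  rw [e] at h1
  exact h1.unique h2

end WeakEquation

end

noncomputable section

/-! ### Iterating the regularity step -/

section Bootstrap

variable {n : ℕ} {Γ : Set (EuclideanSpace ℝ (Fin (n + 1)))}

/-- A sequence `W` with `-Δ_Γ W m = W (m + 1)` and `‖W m‖ ≤ Λᵐ B`. -/
structure IsIteratedSol (W : ℕ → SurfaceL2 Γ) (Λ B : ℝ) : Prop where
  weakSol : ∀ m, IsSurfaceWeakSol (W m) (W (m + 1))
  norm_le : ∀ m, ‖W m‖ ≤ Λ ^ m * B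

theorem IsIteratedSol.shift {W : ℕ → SurfaceL2 Γ} {Λ B : ℝ} (h : IsIteratedSol W Λ B) :
    IsIteratedSol (fun m => W (m + 1)) Λ (Λ * B) :=
  ⟨fun m => h.weakSol (m + 1), fun m => (h.norm_le (m + 1)).trans_eq (by ring)⟩

theorem eLpNorm_two_sq {α E : Type*} [MeasurableSpace α] [NormedAddCommGroup E] (μ : Measure α)
    (g : α → E) : eLpNorm g 2 μ ^ 2 = ∫⁻ x, ‖g x‖ₑ ^ 2 ∂μ := by
  rw [eLpNorm_eq_lintegral_rpow_enorm_toReal (by norm_num) (by norm_num)]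
  simp only [ENNReal.toReal_ofNat, ENNReal.rpow_ofNat]
  rw [← ENNReal.rpow_natCast, ← ENNReal.rpow_mul]
  norm_num

/-- With `r = 0` the weight is 1, so this is Plancherel combined with the `L²` bound for pullback.
-/
theorem exists_scaledSobolevSq_zero_le (κ : SurfaceChart Γ) {χ : EuclideanSpace ℝ (Fin n) → ℂ}
    (hχ : ContDiff ℝ ∞ χ) (hχc : HasCompactSupport χ) (hχU : tsupport χ ⊆ κ.source) :
    ∃ C : ℝ, 0 ≤ C ∧ ∀ (k : ℝ) (w : SurfaceL2 Γ),
      scaledSobolevSq k 0 (fun x => χ x * w (κ.param x)) ≤ ENNReal.ofReal (C * ‖w‖ ^ 2) := by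
  have hK : IsCompact (tsupport χ) := hχc
  have h0 : ∀ x ∉ tsupport χ, χ x = 0 := fun x hx => image_eq_zero_of_notMem_tsupport hx
  obtain ⟨b, hb⟩ := hK.exists_bound_of_continuousOn hχ.continuous.continuousOn
  obtain ⟨C, hC, h⟩ := κ.exists_eLpNorm_comp_param_le hK hχU
  refine ⟨(max b 0 * C) ^ 2, by positivity, fun k w => ?_⟩
  have hw := κ.isLocalL2_comp_param w
  have e : scaledSobolevSq k 0 (fun x => χ x * w (κ.param x)) =
      ∫⁻ x, ‖χ x * w (κ.param x)‖ₑ ^ 2 := by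
    rw [← lintegral_enorm_fourier_sq (hw.memLp_mul hK hχU hχ.continuous.continuousOn h0)
      (hw.integrable_mul hK hχU hχ.continuous.continuousOn h0)]
    simp [scaledSobolevSq, freqWeight]
  rw [e]
  calc ∫⁻ x, ‖χ x * w (κ.param x)‖ₑ ^ 2
      = ∫⁻ x in tsupport χ, ‖χ x * w (κ.param x)‖ₑ ^ 2 := by
        rw [setLIntegral_eq_of_support_subset]
        intro x hx
        by_contra hxK
        exact hx (by simp [h0 x hxK])
    _ ≤ ∫⁻ x in tsupport χ, ENNReal.ofReal (max b 0) ^ 2 * ‖w (κ.param x)‖ₑ ^ 2 := by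
        refine setLIntegral_mono' hK.measurableSet fun x hx => ?_
        rw [enorm_mul, mul_pow]
        gcongr
        rw [← ofReal_norm]
        exact ENNReal.ofReal_le_ofReal ((hb x hx).trans (le_max_left _ _))
    _ = ENNReal.ofReal (max b 0) ^ 2 *
          eLpNorm (fun x => w (κ.param x)) 2 (volume.restrict (tsupport χ)) ^ 2 := by
        rw [lintegral_const_mul' _ _ (by simp), eLpNorm_two_sq]
    _ ≤ ENNReal.ofReal (max b 0) ^ 2 * ENNReal.ofReal (C * ‖w‖) ^ 2 := by
        gcongr
        exact (h w).2
    _ = _ := by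
        rw [← mul_pow, ← ENNReal.ofReal_mul (by positivity), ← ENNReal.ofReal_pow (by positivity)]
        congr 1
        ring

/-- The induction on `r` ranges over all cutoffs, since each step passes from `χ` to a larger `χ'`,
and over all sequences, since it also uses the shifted one. -/
theorem exists_scaledSobolevSq_le (hn : 1 ≤ n) {R k₀ : ℝ} (hR : 0 ≤ R) (hk₀ : 0 < k₀) (r : ℕ) :
    ∀ (κ : SurfaceChart Γ) (χ : EuclideanSpace ℝ (Fin n) → ℂ), ContDiff ℝ ∞ χ →
      HasCompactSupport χ → tsupport χ ⊆ κ.source →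
      ∃ C : ℝ, 0 ≤ C ∧ ∀ k, k₀ ≤ k → ∀ B, 0 ≤ B → ∀ W : ℕ → SurfaceL2 Γ,
        IsIteratedSol W (R * k ^ 2) B →
        scaledSobolevSq k r (fun x => χ x * W 0 (κ.param x)) ≤ ENNReal.ofReal (C * B ^ 2) := by
  induction r with
  | zero =>
    intro κ χ hχ hχc hχU
    obtain ⟨C, hC, h⟩ := exists_scaledSobolevSq_zero_le κ hχ hχc hχU
    refine ⟨C, hC, fun k _ B hB W hW => (h k (W 0)).trans (ENNReal.ofReal_le_ofReal ?_)⟩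
    have := hW.norm_le 0
    rw [pow_zero, one_mul] at this
    gcongr
  | succ r ih =>
    intro κ χ hχ hχc hχU
    obtain ⟨χ', hχ', hχ'c, hχ'U, hχχ'⟩ := exists_cutoff hχc κ.isOpen_source hχU
    obtain ⟨C', hC', h'⟩ := ih κ χ' hχ' hχ'c hχ'U
    obtain ⟨C, hC, h⟩ := exists_scaledSobolevSq_succ_le hn κ.isOpen_source
      κ.contDiffOn_metricCoeff (fun x hx v hv => κ.sum_metricCoeff_pos hx hv)
      κ.contDiffOn_density hχ hχc hχU r hk₀ hχ' hχ'c hχ'U hχχ'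
    refine ⟨C * (C' + C' * R ^ 2), by positivity, fun k hk B hB W hW => ?_⟩
    have hk' : 0 < k := hk₀.trans_le hk
    refine (h k hk _ _ (κ.isLocalL2_comp_param (W 0)) (κ.isLocalL2_comp_param (W 1))
      (hW.weakSol 0 κ)).trans ?_
    have i0 := h' k hk B hB W hW
    -- The shifted sequence has bound `R k² B`; its `k²` cancels the `k⁻²` of the regularity step.
    have i1 := h' k hk (R * k ^ 2 * B) (by positivity) _ hW.shift
    calc _ ≤ ENNReal.ofReal C * (ENNReal.ofReal (C' * B ^ 2) +
          ENNReal.ofReal ((k ^ 2)⁻¹) ^ 2 * ENNReal.ofReal (C' * (R * k ^ 2 * B) ^ 2)) := by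
          gcongr
      _ = _ := by
          rw [← ENNReal.ofReal_pow (by positivity), ← ENNReal.ofReal_mul (by positivity),
            ← ENNReal.ofReal_add (by positivity) (by positivity),
            ← ENNReal.ofReal_mul (by positivity)]
          congr 1
          field_simp

/-- With `m = max 1 k₀⁻¹` one has `m k ≥ 1`, hence `1 + x ≤ m k (1 + x/k)`. Raising to the power `s`
first gives `k^s`; only then is the exponent of `1 + x/k ≥ 1` increased to the integer `r`, so no
extra power of `k` appears. -/
theorem one_add_sq_rpow_le {k₀ k s : ℝ} (hk₀ : 0 < k₀) (hk : k₀ ≤ k) (hs : 0 ≤ s) {r : ℕ}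
    (hr : s ≤ r) {x : ℝ} (hx : 0 ≤ x) :
    (1 + x ^ 2) ^ s ≤ ((max 1 k₀⁻¹ * k) ^ s) ^ 2 * ((1 + x / k) ^ r) ^ 2 := by
  have hk' : 0 < k := hk₀.trans_le hk
  set m := max 1 k₀⁻¹ with hm
  have hm1 : 1 ≤ m := le_max_left _ _
  have hmk : 1 ≤ m * k := by
    have h1 : k₀⁻¹ ≤ m := le_max_right _ _
    calc (1 : ℝ) = k₀⁻¹ * k₀ := (inv_mul_cancel₀ hk₀.ne').symm
      _ ≤ m * k := by gcongr
  set y := m * k * (1 + x / k) with hy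
  have hy0 : 0 ≤ y := by positivity
  have hxy : 1 + x ≤ y := by
    have : y = m * k + m * x := by rw [hy]; field_simp
    rw [this]
    nlinarith
  have h1 : 1 + x ^ 2 ≤ y ^ 2 := by nlinarith
  have h2 : (1 + x / k) ^ s ≤ (1 + x / k) ^ r := by
    rw [← Real.rpow_natCast]
    refine Real.rpow_le_rpow_of_exponent_le ?_ hr
    have : 0 ≤ x / k := by positivity
    linarith
  calc (1 + x ^ 2) ^ s ≤ (y ^ 2) ^ s := Real.rpow_le_rpow (by positivity) h1 hs
    _ = (y ^ s) ^ 2 := by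
      rw [← Real.rpow_natCast, ← Real.rpow_natCast, ← Real.rpow_mul hy0, ← Real.rpow_mul hy0,
        mul_comm]
    _ = ((m * k) ^ s) ^ 2 * ((1 + x / k) ^ s) ^ 2 := by
      rw [hy, Real.mul_rpow (by positivity) (by positivity), mul_pow]
    _ ≤ _ := by gcongr

theorem sobolevENorm_sq_le {g : EuclideanSpace ℝ (Fin n) → ℂ} (h2 : MemLp g 2 volume)
    (h1 : Integrable g volume) {k₀ k s : ℝ} (hk₀ : 0 < k₀) (hk : k₀ ≤ k) (hs : 0 ≤ s) {r : ℕ}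
    (hr : s ≤ r) :
    sobolevENorm s g ^ 2 ≤
      ENNReal.ofReal (((max 1 k₀⁻¹ * k) ^ s) ^ 2) * scaledSobolevSq k r g := by
  have hk' : 0 < k := hk₀.trans_le hk
  rw [sobolevENorm, dif_pos h2, ← ENNReal.rpow_natCast, ← ENNReal.rpow_mul]
  norm_num only [Nat.cast_ofNat, ENNReal.rpow_one]
  unfold scaledSobolevSq
  rw [← lintegral_const_mul' _ _ ENNReal.ofReal_ne_top]
  refine lintegral_mono_ae ?_
  filter_upwards [fourier_toLp_ae_eq h2 h1] with ξ hξ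
  rw [hξ, mul_pow, ← mul_assoc]
  gcongr
  rw [freqWeight, ← ENNReal.ofReal_pow (by positivity), ← ENNReal.ofReal_mul (by positivity)]
  exact ENNReal.ofReal_le_ofReal (one_add_sq_rpow_le hk₀ hk hs hr (norm_nonneg ξ))

end Bootstrap

/-! ### Cutoffs of the atlas in local coordinates -/

section Atlas

variable {n : ℕ} {Γ : Set (EuclideanSpace ℝ (Fin (n + 1)))}

/-- The set is the image of `T` under the inverse chart, which is continuous because `param` is open
onto its image in `Γ`. -/
theorem SurfaceChart.isCompact_preimage (κ : SurfaceChart Γ)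
    {T : Set (EuclideanSpace ℝ (Fin (n + 1)))} (hT : IsCompact T) (hTs : T ⊆ κ.param '' κ.source) :
    IsCompact (κ.source ∩ κ.param ⁻¹' T) := by
  set g := Function.invFunOn κ.param κ.source
  have hg : ∀ x ∈ κ.source, g (κ.param x) = x := fun x hx =>
    κ.injOn_param.leftInvOn_invFunOn hx
  have hcont : ContinuousOn g (κ.param '' κ.source) := by
    refine continuousOn_iff'.2 fun W hW => ?_
    obtain ⟨O, hO, hWO⟩ := κ.isOpen_image (W ∩ κ.source) Set.inter_subset_right
      (hW.inter κ.isOpen_source)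
    refine ⟨O, hO, ?_⟩
    ext y
    constructor
    · rintro ⟨hy, x, hx, rfl⟩
      refine ⟨?_, x, hx, rfl⟩
      have hxW : x ∈ W := by rwa [Set.mem_preimage, hg x hx] at hy
      have : κ.param x ∈ Γ ∩ O := hWO ▸ Set.mem_image_of_mem _ ⟨hxW, hx⟩
      exact this.2
    · rintro ⟨hy, x, hx, rfl⟩
      have : κ.param x ∈ κ.param '' (W ∩ κ.source) := hWO ▸ ⟨κ.mapsTo_param hx, hy⟩
      obtain ⟨z, hz, hzx⟩ := this
      refine ⟨?_, x, hx, rfl⟩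
      rw [Set.mem_preimage, hg x hx, ← κ.injOn_param hz.2 hx hzx]
      exact hz.1
  have e : κ.source ∩ κ.param ⁻¹' T = g '' T := by
    ext x
    constructor
    · rintro ⟨hx, hxT⟩
      exact ⟨κ.param x, hxT, hg x hx⟩
    · rintro ⟨y, hy, rfl⟩
      obtain ⟨x, hx, rfl⟩ := hTs hy
      rw [hg x hx]
      exact ⟨hx, hy⟩
  rw [e]
  exact hT.image_of_continuousOn (hcont.mono hTs)

/-- In local coordinates, the functions of the partition of unity are test functions. -/
theorem SobolevAtlas.exists_localPiece_eq (A : SobolevAtlas Γ) (hΓ : IsCompact Γ)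
    (i : Fin A.size) :
    ∃ χ : EuclideanSpace ℝ (Fin n) → ℂ, ContDiff ℝ ∞ χ ∧ HasCompactSupport χ ∧
      tsupport χ ⊆ (A.chart i).source ∧ ∀ w : EuclideanSpace ℝ (Fin (n + 1)) → ℂ,
        A.localPiece i w = fun x => χ x * w ((A.chart i).param x) := by
  set κ := A.chart i
  set K := κ.source ∩ κ.param ⁻¹' (Γ ∩ tsupport (A.cutoff i))
  have hK : IsCompact K := κ.isCompact_preimage (hΓ.inter_right (isClosed_tsupport _))
    (A.support_cutoff i)
  set χ : EuclideanSpace ℝ (Fin n) → ℂ :=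
    κ.source.indicator fun x => (A.cutoff i (κ.param x) : ℂ) with hχ
  have h0 : ∀ x ∉ K, χ x = 0 := fun x hx => by
    by_cases hxs : x ∈ κ.source
    · have h : κ.param x ∉ tsupport (A.cutoff i) := fun h => hx ⟨hxs, κ.mapsTo_param hxs, h⟩
      rw [hχ, Set.indicator_of_mem hxs, image_eq_zero_of_notMem_tsupport h, Complex.ofReal_zero]
    · exact Set.indicator_of_notMem hxs _
  refine ⟨χ, contDiff_iff_contDiffAt.2 fun x => ?_, HasCompactSupport.intro hK h0, ?_,
    fun w => ?_⟩
  · by_cases hx : x ∈ K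
    · have h1 : ContDiffOn ℝ ∞ (fun x => (A.cutoff i (κ.param x) : ℂ)) κ.source :=
        Complex.ofRealCLM.contDiff.comp_contDiffOn
          ((A.contDiff_cutoff i).comp_contDiffOn κ.contDiffOn_param)
      have hnhds := κ.isOpen_source.mem_nhds hx.1
      refine (h1.contDiffAt hnhds).congr_of_eventuallyEq ?_
      filter_upwards [hnhds] with y hy using Set.indicator_of_mem hy _
    · have : χ =ᶠ[nhds x] fun _ => 0 := by
        filter_upwards [hK.isClosed.isOpen_compl.mem_nhds hx] with y hy using h0 y hy
      exact contDiffAt_const.congr_of_eventuallyEq this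
  · refine (closure_minimal (fun x hx => ?_) hK.isClosed).trans Set.inter_subset_left
    by_contra hxK
    exact hx (h0 x hxK)
  · funext x
    by_cases hx : x ∈ κ.source
    · simp only [SobolevAtlas.localPiece, hχ]
      rw [Set.indicator_of_mem hx, Set.indicator_of_mem hx, Complex.real_smul]
    · simp only [SobolevAtlas.localPiece, hχ]
      rw [Set.indicator_of_notMem hx, Set.indicator_of_notMem hx, zero_mul]

end Atlas

/-! ### Spectral bounds for the iterates -/

section FunctionalCalculus

variable {n : ℕ} {Γ : Set (EuclideanSpace ℝ (Fin (n + 1)))}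

/-- Parseval: the operator multiplies the `j`-th coefficient by `f (c * lam j)`. -/
theorem norm_funcLaplace_le (u : HilbertBasis ℕ ℂ (SurfaceL2 Γ)) (lam : ℕ → ℝ) {f : ℝ → ℂ}
    (c : ℝ) (v : SurfaceL2 Γ) {M : ℝ} (hM : ∀ t, ‖f t‖ ≤ M) :
    ‖funcLaplace u lam f c v‖ ≤ M * ‖v‖ := by
  have hM0 : 0 ≤ M := (norm_nonneg _).trans (hM 0)
  have hsum := hasSum_funcLaplace u lam f c v hM
  have hcoef : ∀ j, u.repr (funcLaplace u lam f c v) j = f (c * lam j) * u.repr v j := by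
    intro j
    rw [u.repr_apply_apply, u.repr_apply_apply]
    have h1 := hsum.mapL (innerSL ℂ (u j))
    refine h1.unique ?_
    have h2 : ∀ i, innerSL ℂ (u j) ((f (c * lam i) * inner ℂ (u i) v) • u i) =
        if i = j then f (c * lam j) * inner ℂ (u j) v else 0 := by
      intro i
      rw [innerSL_apply_apply, inner_smul_right, orthonormal_iff_ite.1 u.orthonormal j i]
      by_cases h : i = j
      · simp [h]
      · simp [h, Ne.symm h]
    simp only [h2]
    exact hasSum_ite_eq j _
  calc ‖funcLaplace u lam f c v‖ = ‖u.repr (funcLaplace u lam f c v)‖ := (u.repr.norm_map _).symm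
    _ ≤ ‖(M : ℂ) • u.repr v‖ := by
      refine lp.norm_mono (by norm_num) fun j => ?_
      rw [hcoef, lp.coeFn_smul, Pi.smul_apply, smul_eq_mul, norm_mul, norm_mul]
      gcongr
      simpa [abs_of_nonneg hM0] using hM (c * lam j)
    _ = M * ‖v‖ := by
      rw [norm_smul, u.repr.norm_map]
      simp [abs_of_nonneg hM0]

/-- At `t = k⁻² λⱼ` the factor `(k² t)^m` is `λⱼ^m`, so the `m`-th term is `(-Δ_Γ)^m` applied to
`f(-k⁻²Δ_Γ)v`. On the support of `f` this factor is at most `(R k²)^m`. -/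
theorem isIteratedSol_funcLaplace {u : HilbertBasis ℕ ℂ (SurfaceL2 Γ)} {lam : ℕ → ℝ}
    (hu : ∀ j, IsLaplaceEigen Γ (u j) (lam j)) {f : ℝ → ℂ} {M R : ℝ} (hM : ∀ t, ‖f t‖ ≤ M)
    (hR0 : 0 ≤ R) (hR : ∀ t, f t ≠ 0 → |t| ≤ R) {k : ℝ} (hk : 0 < k) (v : SurfaceL2 Γ) :
    IsIteratedSol (fun m => funcLaplace u lam (fun t => ((k ^ 2 * t : ℝ) : ℂ) ^ m * f t)
      (k ^ 2)⁻¹ v) (R * k ^ 2) (M * ‖v‖) := by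
  have hbound : ∀ (m : ℕ) t, ‖((k ^ 2 * t : ℝ) : ℂ) ^ m * f t‖ ≤ (R * k ^ 2) ^ m * M := by
    intro m t
    by_cases ht : f t = 0
    · rw [ht, mul_zero, norm_zero]
      exact mul_nonneg (by positivity) ((norm_nonneg _).trans (hM t))
    · rw [norm_mul, norm_pow, Complex.norm_real, Real.norm_eq_abs, abs_mul,
        abs_of_nonneg (sq_nonneg k), mul_comm (k ^ 2)]
      gcongr
      · exact hR t ht
      · exact hM t
  refine ⟨fun m => ?_, fun m => ?_⟩
  · have h1 := hasSum_funcLaplace u lam _ (k ^ 2)⁻¹ v (hbound m)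
    have h2 := hasSum_funcLaplace u lam _ (k ^ 2)⁻¹ v (hbound (m + 1))
    refine isSurfaceWeakSol_of_hasSum hu h1 ?_
    convert! h2 using 3 with j
    rw [mul_inv_cancel_left₀ (by positivity)]
    ring
  · rw [← mul_assoc]
    exact norm_funcLaplace_le u lam _ v (hbound m)

end FunctionalCalculus

end

/-! ### The estimate on `Γ` -/

theorem lemma5p2 (n : ℕ) (hn : 1 ≤ n) (Ω : Set (EuclideanSpace ℝ (Fin (n + 1))))
    (hΩ_open : IsOpen Ω) (hΩ_bounded : Bornology.IsBounded Ω)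
    (hΩ_smooth : IsSmoothHypersurface (frontier Ω)) (A : SobolevAtlas (frontier Ω))
    (f : ℝ → ℂ) (hf_bounded : ∃ M : ℝ, ∀ t, ‖f t‖ ≤ M) (hf_supp : HasCompactSupport f)
    (s : ℝ) (hs : 0 ≤ s) (k₀ : ℝ) (hk₀ : 0 < k₀) :
    ∃ C : ℝ, 0 < C ∧
      ∀ (u : HilbertBasis ℕ ℂ (SurfaceL2 (frontier Ω))) (lam : ℕ → ℝ),
        (∀ j, IsLaplaceEigen (frontier Ω) (u j) (lam j)) →
          ∀ k : ℝ, k₀ ≤ k → ∀ v : SurfaceL2 (frontier Ω),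
            A.surfaceSobolevENorm s (funcLaplace u lam f (k ^ 2)⁻¹ v) ≤
              ENNReal.ofReal (C * k ^ s * ‖v‖) := by
  have hΓ : IsCompact (frontier Ω) :=
    Metric.isCompact_of_isClosed_isBounded isClosed_frontier
      (hΩ_bounded.closure.subset frontier_subset_closure)
  obtain ⟨M, hM⟩ := hf_bounded
  have hM0 : 0 ≤ M := (norm_nonneg _).trans (hM 0)
  obtain ⟨R₀, hR₀⟩ := hf_supp.isCompact.exists_bound_of_continuousOn (f := fun t : ℝ => t)
    continuousOn_id
  set R := max R₀ 0
  have hR : ∀ t, f t ≠ 0 → |t| ≤ R := fun t ht =>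
    (hR₀ t (subset_tsupport f ht)).trans (le_max_left _ _)
  set r := ⌈s⌉₊
  choose χ hχ hχc hχU hχeq using A.exists_localPiece_eq hΓ
  choose C hC hmain using fun i => exists_scaledSobolevSq_le (Γ := frontier Ω) hn
    (le_max_right R₀ 0) hk₀ r (A.chart i) (χ i) (hχ i) (hχc i) (hχU i)
  set m := max 1 k₀⁻¹
  set S := ∑ i, C i
  have hS : 0 ≤ S := Finset.sum_nonneg fun i _ => hC i
  -- The summand 1 only ensures positivity, as `M` or `S` may be 0. All constants are fixed before
  -- the basis, `k` and `v`.
  refine ⟨m ^ s * √S * M + 1, by positivity, fun u lam hu k hk v => ?_⟩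
  have hk' : 0 < k := hk₀.trans_le hk
  have hW := isIteratedSol_funcLaplace hu hM (le_max_right R₀ 0) hR hk' v
  set w := funcLaplace u lam f (k ^ 2)⁻¹ v with hw
  have hw0 : funcLaplace u lam (fun t => ((k ^ 2 * t : ℝ) : ℂ) ^ 0 * f t) (k ^ 2)⁻¹ v = w := by
    simp only [pow_zero, one_mul, hw]
  have piece : ∀ i, sobolevENorm s (A.localPiece i w) ^ 2 ≤
      ENNReal.ofReal (((m * k) ^ s) ^ 2 * (C i * (M * ‖v‖) ^ 2)) := by
    intro i
    have hloc := (A.chart i).isLocalL2_comp_param w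
    have h0 : ∀ x ∉ tsupport (χ i), χ i x = 0 := fun x hx => image_eq_zero_of_notMem_tsupport hx
    have h := hmain i k hk (M * ‖v‖) (by positivity) _ hW
    simp only [hw0] at h
    rw [hχeq, ENNReal.ofReal_mul (by positivity)]
    refine (sobolevENorm_sq_le
      (hloc.memLp_mul (hχc i) (hχU i) (hχ i).continuous.continuousOn h0)
      (hloc.integrable_mul (hχc i) (hχU i) (hχ i).continuous.continuousOn h0) hk₀ hk hs
      (Nat.le_ceil s)).trans ?_
    gcongr
  have hsq : (m * k) ^ s * (√S * (M * ‖v‖)) ≤ (m ^ s * √S * M + 1) * k ^ s * ‖v‖ := by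
    rw [Real.mul_rpow (by positivity) hk'.le]
    have : 0 ≤ k ^ s * ‖v‖ := by positivity
    linarith
  calc A.surfaceSobolevENorm s w
      ≤ (∑ i, ENNReal.ofReal (((m * k) ^ s) ^ 2 * (C i * (M * ‖v‖) ^ 2))) ^ (1 / 2 : ℝ) :=
        ENNReal.rpow_le_rpow (Finset.sum_le_sum fun i _ => piece i) (by norm_num)
    _ = ENNReal.ofReal (((m * k) ^ s * (√S * (M * ‖v‖))) ^ 2) ^ (1 / 2 : ℝ) := by
        rw [← ENNReal.ofReal_sum_of_nonneg fun i _ => mul_nonneg (by positivity)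
          (mul_nonneg (hC i) (by positivity)), ← Finset.mul_sum, ← Finset.sum_mul,
          mul_pow _ (√S * _), mul_pow √S, Real.sq_sqrt hS]
    _ = ENNReal.ofReal ((m * k) ^ s * (√S * (M * ‖v‖))) := by
        rw [ENNReal.ofReal_pow (by positivity), ← ENNReal.rpow_natCast, ← ENNReal.rpow_mul]
        norm_num
    _ ≤ _ := ENNReal.ofReal_le_ofReal hsq
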